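/- Let $X$ be a finite regular CW complex, i.e. a Hausdorff space with a CW structure with finitely many cells in which every cell has a characteristic map that is a homeomorphism from the closed ball onto the closed cell. For cells $x,y$ write $x>y$ if the closure of $y$ is contained in the boundary of $x$. Let $\mathbf{Ent}(X)$ be the entrance path category of $X$, a category enriched over posets: its objects are the cells of $X$; the morphisms from $x$ to $y$ are the strictly descending sequences $(x=x_0>x_1>\cdots>x_k=y)$ of cells with $k\ge 0$, where $f\Rightarrow f'$ if and only if $f$ is a (not necessarily contiguous) subsequence of $f'$; the composite of $f=(x_0>\cdots>x_k)$ and $g=(x_k=y_0>\cdots>y_\ell)$ is the concatenation $f\circ g=(x_0>\cdots>x_k=y_0>\cdots>y_\ell)$; and the identity of $x$ is $(x)$. Let $\Delta\,\mathbf{Ent}(X)$ be its geometric nerve: the simplicial set whose $n$-simplices consist of objects $x_0,\dots,x_n$ and morphisms $f_{ij}:x_i\to x_j$ for $0\le i\le j\le n$ such that $f_{ii}=1_{x_i}$ for all $i$, and $f_{ik}\Rightarrow f_{ij}\circ f_{jk}$ for all $i\le j\le k$, with the simplicial operators given by reindexing. Then $X$ is homotopy-equivalent to the classifying space $|\Delta\,\mathbf{Ent}(X)|$,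 the geometric realization of this nerve. -/

import Mathlib

open CategoryTheory Topology ContinuousMap Simplicial

/-- A small category enriched over posets: every set of morphisms is partially ordered, and
composition (written in diagrammatic order) is monotone in both variables. -/
class PCategory.{w, v} (E : Type v) extends Category.{w} E where
  homOrder (x y : E) : PartialOrder (x ⟶ y)
  comp_mono {x y z : E} {f f' : x ⟶ y} {g g' : y ⟶ z} :
    (homOrder x y).le f f' → (homOrder y z).le g g' →
      (homOrder x z).le (f ≫ g) (f' ≫ g')

namespace PCategory

instance {E : Type*} [PCategory E] (x y : E) : PartialOrder (x ⟶ y) := homOrder x y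

/-- An `n`-simplex of the (oplax) geometric nerve: objects `x₀, …, xₙ` and morphisms
`f i j : x i ⟶ x j` for `i ≤ j` such that `f i i = 𝟙` and `f i k ≤ f i j ≫ f j k`
for `i ≤ j ≤ k`. -/
@[ext]
structure NerveSimplex.{w, v} (E : Type v) [PCategory.{w} E] (n : ℕ) : Type (max w v) where
  obj : Fin (n + 1) → E
  hom (i j : Fin (n + 1)) (h : i ≤ j) : obj i ⟶ obj j
  hom_self (i : Fin (n + 1)) : hom i i le_rfl = 𝟙 (obj i)
  hom_le (i j k : Fin (n + 1)) (hij : i ≤ j) (hjk : j ≤ k) :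
    hom i k (hij.trans hjk) ≤ hom i j hij ≫ hom j k hjk

/-- Pulling back a simplex along a monotone map `[m] → [n]`. -/
def NerveSimplex.pullback {E : Type*} [PCategory E] {m n : ℕ} (s : NerveSimplex E n)
    (θ : Fin (m + 1) →o Fin (n + 1)) : NerveSimplex E m where
  obj i := s.obj (θ i)
  hom i j h := s.hom (θ i) (θ j) (θ.monotone h)
  hom_self i := s.hom_self (θ i)
  hom_le _ _ _ hij hjk := s.hom_le _ _ _ (θ.monotone hij) (θ.monotone hjk)

/-- The (oplax) geometric nerve of a poset-enriched category. -/
def geometricNerve.{w, v} (E : Type v) [PCategory.{w} E] : SSet.{max w v} where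
  obj n := NerveSimplex E n.unop.len
  map θ := ↾fun s => s.pullback θ.unop.toOrderHom

/-- The classifying space: the geometric realization of the geometric nerve. -/
noncomputable def classifyingSpace.{w, v} (E : Type v) [PCategory.{w} E] : TopCat.{max w v} :=
  |geometricNerve E|

end PCategory

section EntrancePaths

universe u

variable {X : Type u} [TopologicalSpace X]

/-- A CW complex is regular if every cell has a characteristic map which is a homeomorphism from
the closed ball onto the closed cell (carrying the open ball onto the open cell and the sphere
onto the boundary of the cell). -/
def Topology.CWComplex.IsRegular (C : Set X) [CWComplex C] : Prop :=
  ∀ (n : ℕ) (i : RelCWComplex.cell C n), ∃ φ : (Fin n → ℝ) → X,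
    IsEmbedding ((Metric.closedBall 0 1).domRestrict φ) ∧
      φ '' Metric.ball 0 1 = RelCWComplex.openCell n i ∧
      φ '' Metric.sphere 0 1 = RelCWComplex.cellFrontier n i

/-- The cells of a CW complex, of all dimensions: these are the objects of its entrance path
category. -/
structure Ent (C : Set X) [CWComplex C] : Type u where
  dim : ℕ
  index : RelCWComplex.cell C dim

namespace Ent

variable {C : Set X} [CWComplex C]

/-- The strict face relation `x > y`: the closure of `y` is contained in the boundary of `x`. -/
def StrictFace (x y : Ent C) : Prop :=
  RelCWComplex.closedCell y.dim y.index ⊆ RelCWComplex.cellFrontier x.dim x.index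

/-- An entrance path from `x` to `y`: a strictly descending sequence of cells
`x = x₀ > x₁ > ⋯ > xₖ = y`. -/
@[ext]
structure EntrancePath (x y : Ent C) : Type u where
  cells : List (Ent C)
  isChain : cells.IsChain StrictFace
  head_eq : cells.head? = some x
  last_eq : cells.getLast? = some y

namespace EntrancePath

/-- Entrance paths are ordered by inclusion as (not necessarily contiguous) subsequences. -/
instance (x y : Ent C) : PartialOrder (EntrancePath x y) where
  le f g := f.cells.Sublist g.cells
  le_refl f := List.Sublist.refl _
  le_trans _ _ _ := List.Sublist.trans
  le_antisymm _ _ h h' := EntrancePath.ext (h.antisymm h')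

/-- The trivial entrance path `(x)`. -/
def refl (x : Ent C) : EntrancePath x x where
  cells := [x]
  isChain := List.isChain_singleton x
  head_eq := rfl
  last_eq := rfl

lemma cells_eq {x y : Ent C} (f : EntrancePath x y) : f.cells = x :: f.cells.tail := by
  obtain ⟨t, ht⟩ := List.head?_eq_some_iff.1 f.head_eq
  simp [ht]

/-- Concatenation of entrance paths, with the common cell written once. -/
def comp {x y z : Ent C} (f : EntrancePath x y) (g : EntrancePath y z) : EntrancePath x z where
  cells := f.cells ++ g.cells.tail
  isChain := by
    have hg := g.isChain
    rw [g.cells_eq, List.isChain_cons] at hg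
    refine List.isChain_append.2 ⟨f.isChain, hg.2, fun a ha b hb => ?_⟩
    rw [f.last_eq] at ha
    obtain rfl : y = a := by simpa using ha
    exact hg.1 b hb
  head_eq := by rw [f.cells_eq]; rfl
  last_eq := by
    have hg := g.last_eq
    rw [g.cells_eq] at hg
    rw [List.getLast?_append, f.last_eq]
    cases h : g.cells.tail with
    | nil => simpa [h] using hg
    | cons a t =>
      rw [h, List.getLast?_cons_cons] at hg
      rw [hg]
      rfl

end EntrancePath

/-- The entrance path category of a CW complex. -/
instance : PCategory.{u} (Ent C) where
  Hom := EntrancePath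
  id := EntrancePath.refl
  comp := EntrancePath.comp
  id_comp {x y} f := EntrancePath.ext f.cells_eq.symm
  comp_id f := EntrancePath.ext (List.append_nil _)
  assoc f g h := by
    apply EntrancePath.ext
    change (f.cells ++ g.cells.tail) ++ h.cells.tail =
      f.cells ++ (g.cells ++ h.cells.tail).tail
    rw [g.cells_eq]
    simp
  homOrder _ _ := inferInstance
  comp_mono {x y z f f' g g'} hf hg := by
    change (EntrancePath.cells f ++ (EntrancePath.cells g).tail).Sublist
      (EntrancePath.cells f' ++ (EntrancePath.cells g').tail)
    exact List.Sublist.append hf hg.tail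

end Ent

end EntrancePaths

/-! Order the cells so that `x ≤ y` when `y` is `x` or a strict face of `x`. Both spaces are
compared with the order complex of this poset.

Topological half: the complex is homeomorphic to the order complex
(`Ent.nonempty_homeomorph_orderPolytope`). A regular closed cell is a cone over its boundary sphere,
so a parametrization of the boundary extends radially over the cell, and cells are added one at a
time after their faces. This requires the boundary of a cell to be a union of open cells, which the
definition of a CW complex does not give. It follows from regularity by invariance of domain
(`Ent.exists_closedCell_subset_boundary`), which is derived here from Brouwer's fixed point theorem.

Categorical half: for `x ≤ y` the poset of entrance paths has a least element, the path through `x`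
and `y` only. Taking vertices maps the nerve of the entrance path category to the nerve of the
poset, and least paths give a section. The other composite is simplicially homotopic to the
identity: replace the morphisms starting in an initial segment of the vertices by least paths. The
nerve inequalities survive because a least path lies below everything. An explicit subdivision of
prisms turns this into a homotopy of realizations. -/

/-! ### Brouwer's fixed point theorem and invariance of domain -/

section Brouwer

open MeasureTheory Metric Set Filter

/-- For an endomorphism `A` of a finite-dimensional space, `det (1 + t A)` is a polynomial in `t`
of degree at most the dimension. -/
lemma exists_polynomial_eval_eq_det_one_add_smul {E : Type*} [NormedAddCommGroup E]
    [NormedSpace ℝ E] [FiniteDimensional ℝ E] (A : E →L[ℝ] E) :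
    ∃ p : Polynomial ℝ, p.degree < (Module.finrank ℝ E + 1 : ℕ) ∧
      ∀ t : ℝ, p.eval t = (1 + t • A : E →L[ℝ] E).det := by
  classical
  let b := Module.finBasis ℝ E
  let M := LinearMap.toMatrix b b (A : E →ₗ[ℝ] E)
  refine ⟨((Polynomial.X : Polynomial ℝ) • M.map Polynomial.C +
    (1 : Matrix _ _ ℝ).map Polynomial.C).det, ?_, fun t => ?_⟩
  · refine lt_of_le_of_lt Polynomial.degree_le_natDegree ?_
    have := Polynomial.natDegree_det_X_add_C_le M 1
    rw [Fintype.card_fin] at this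
    exact_mod_cast Nat.lt_succ_of_le this
  · have h1 := RingHom.map_det (Polynomial.evalRingHom t)
      ((Polynomial.X : Polynomial ℝ) • M.map Polynomial.C + (1 : Matrix _ _ ℝ).map Polynomial.C)
    rw [Polynomial.coe_evalRingHom] at h1
    rw [h1, ContinuousLinearMap.det, ← LinearMap.det_toMatrix b]
    congr 1
    have h2 : LinearMap.toMatrix b b ((1 + t • A : E →L[ℝ] E) : E →ₗ[ℝ] E) = 1 + t • M := by
      have : ((1 + t • A : E →L[ℝ] E) : E →ₗ[ℝ] E) = LinearMap.id + t • (A : E →ₗ[ℝ] E) := by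
        ext; simp
      rw [this, map_add, map_smul, LinearMap.toMatrix_id]
    rw [h2]
    ext i j
    by_cases hij : i = j <;> simp [hij, add_comm, mul_comm t]

variable {E : Type*} [NormedAddCommGroup E] [InnerProductSpace ℝ E] [FiniteDimensional ℝ E]

/-- The determinant of the derivative of a map into a sphere vanishes. -/
lemma det_fderiv_eq_zero_of_norm_eq {r : E → E} (hr : Differentiable ℝ r) {ρ : ℝ}
    (hρ : 0 < ρ) (h : ∀ x, ‖r x‖ = ρ) (x : E) : (fderiv ℝ r x).det = 0 := by
  by_contra hdet
  have h1 : HasFDerivAt (fun y => inner ℝ (r y) (r y)) _ x :=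
    (hr x).hasFDerivAt.inner ℝ (hr x).hasFDerivAt
  have h2 : (fun y => inner ℝ (r y) (r y)) = fun _ => ρ ^ 2 := by
    funext y; rw [real_inner_self_eq_norm_sq, h]
  rw [h2] at h1
  have h3 := h1.unique (hasFDerivAt_const (ρ ^ 2) x)
  -- Differentiating `‖r‖² = ρ²` shows that the range of the derivative is orthogonal to `r x`. An
  -- invertible derivative would attain the nonzero vector `r x` itself.
  obtain ⟨v, hv⟩ := (LinearMap.equivOfDetNeZero (fderiv ℝ r x : E →ₗ[ℝ] E) hdet).surjective (r x)
  have hv' : fderiv ℝ r x v = r x := hv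
  have h4 := congrArg (fun L => L v) h3
  simp [hv', h] at h4
  exact hρ.ne' h4

/-- For small `t` the map `x ↦ x + t g x` is a bijection of the open ball onto itself, if
`x + g x` retracts the space smoothly onto the sphere. -/
lemma image_ball_add_smul_sub {r : E → E} (hr : ContDiff ℝ 1 r) {ρ : ℝ} (hρ : 0 < ρ)
    (h : ∀ x, ‖r x‖ = ρ) (hid : ∀ x, ‖x‖ = ρ → r x = x) {t : ℝ} (ht0 : 0 ≤ t) (ht1 : t < 1)
    (hdet : ∀ x ∈ closedBall (0 : E) ρ, (1 + t • fderiv ℝ (fun x => r x - x) x).det ≠ 0) :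
    (fun x => x + t • (r x - x)) '' ball 0 ρ = ball 0 ρ := by
  set H : E → E := fun x => x + t • (r x - x) with hH
  have hmaps : ∀ x ∈ ball (0 : E) ρ, H x ∈ ball (0 : E) ρ := by
    intro x hx
    rw [mem_ball_zero_iff] at hx ⊢
    have : H x = (1 - t) • x + t • r x := by simp only [hH]; module
    rw [this]
    calc ‖(1 - t) • x + t • r x‖ ≤ ‖(1 - t) • x‖ + ‖t • r x‖ := norm_add_le _ _
      _ = (1 - t) * ‖x‖ + t * ρ := by
        rw [norm_smul, norm_smul, h, Real.norm_of_nonneg ht0, Real.norm_of_nonneg (by linarith)]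
      _ < (1 - t) * ρ + t * ρ := by
        have := mul_lt_mul_of_pos_left hx (show 0 < 1 - t by linarith)
        linarith
      _ = ρ := by ring
  have hHc : Continuous H := by
    have := hr.continuous
    fun_prop
  have hopen : IsOpen (H '' ball 0 ρ) := by
    rw [isOpen_iff_mem_nhds]
    rintro _ ⟨x, hx, rfl⟩
    have hg : ContDiff ℝ 1 (fun x => r x - x) := hr.sub contDiff_id
    have hs : HasStrictFDerivAt H (1 + t • fderiv ℝ (fun x => r x - x) x) x :=
      (hasStrictFDerivAt_id x).add
        ((hg.contDiffAt.hasStrictFDerivAt one_ne_zero).const_smul t)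
    have hd := hdet x (ball_subset_closedBall hx)
    have hs' : HasStrictFDerivAt H
        ((ContinuousLinearMap.toContinuousLinearEquivOfDetNeZero _ hd : E ≃L[ℝ] E) : E →L[ℝ] E)
        x := by
      convert hs using 1
      ext; rfl
    rw [← hs'.map_nhds_eq_of_equiv]
    exact image_mem_map (isOpen_ball.mem_nhds hx)
  refine Subset.antisymm (image_subset_iff.2 hmaps) ?_
  have hK : IsClosed (H '' closedBall 0 ρ) :=
    ((isCompact_closedBall (0 : E) ρ).image hHc).isClosed
  -- The image of the open ball is open, and also closed in the ball: a point of the ball in the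
  -- compact image of the closed ball cannot come from the sphere, which `H` fixes.
  refine IsPreconnected.subset_left_of_subset_union (v := (H '' closedBall 0 ρ)ᶜ) hopen
    hK.isOpen_compl ?_ ?_ ?_ (convex_ball (0 : E) ρ).isPreconnected
  · exact disjoint_compl_right.mono_left (image_mono ball_subset_closedBall)
  · intro y hy
    by_cases hy' : y ∈ H '' closedBall 0 ρ
    · left
      obtain ⟨x, hx, rfl⟩ := hy'
      refine ⟨x, ?_, rfl⟩
      rw [mem_closedBall_zero_iff] at hx
      rw [mem_ball_zero_iff]
      refine lt_of_le_of_ne hx fun hx' => ?_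
      have : H x = x := by simp [hH, hid x hx']
      rw [this, mem_ball_zero_iff] at hy
      exact hy.ne hx'
    · exact Or.inr hy'
  · exact ⟨H 0, hmaps 0 (by simpa), 0, by simpa, rfl⟩

/-- There is no smooth map into the sphere of radius `ρ` fixing that sphere pointwise. -/
theorem not_exists_smooth_retraction_sphere {r : E → E} (hr : ContDiff ℝ 1 r) {ρ : ℝ}
    (hρ : 0 < ρ) (h : ∀ x, ‖r x‖ = ρ) : ∃ x, ‖x‖ = ρ ∧ r x ≠ x := by
  by_contra! hid
  let _ : MeasurableSpace E := borel E
  have : BorelSpace E := ⟨rfl⟩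
  let g : E → E := fun x => r x - x
  have hg : ContDiff ℝ 1 g := hr.sub contDiff_id
  have hdg : Continuous (fderiv ℝ g) := hg.continuous_fderiv one_ne_zero
  have hdetc : Continuous fun z : ℝ × E => (1 + z.1 • fderiv ℝ g z.2).det :=
    ContinuousLinearMap.continuous_det.comp (by fun_prop)
  have hK := isCompact_closedBall (0 : E) ρ
  obtain ⟨c, hc⟩ := hK.exists_bound_of_continuousOn hdg.continuousOn
  have hpos : ∀ᶠ t : ℝ in 𝓝 0, ∀ x ∈ closedBall (0 : E) ρ, 0 < (1 + t • fderiv ℝ g x).det := by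
    refine hK.eventually_forall_of_forall_eventually fun x _ => ?_
    refine hdetc.continuousAt.eventually (lt_mem_nhds ?_)
    simp [ContinuousLinearMap.det]
  -- As `c` bounds the derivative of `g`, this makes `t • g` a contraction on the ball, so that `x +
  -- t • g x` is injective there.
  have hsmall : ∀ᶠ t : ℝ in 𝓝 0, |t| * c < 1 := by
    have : Continuous fun t : ℝ => |t| * c := by fun_prop
    exact this.continuousAt.eventually (gt_mem_nhds (by simp))
  obtain ⟨ε, hε, hball⟩ := Metric.eventually_nhds_iff.1 (hpos.and hsmall)
  have key : ∀ t : ℝ, 0 ≤ t → t < ε → t < 1 →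
      ∫ x in ball (0 : E) ρ, (1 + t • fderiv ℝ g x).det = volume.real (ball (0 : E) ρ) := by
    intro t ht0 htε ht1
    obtain ⟨hp, hs⟩ := hball (y := t) (by rwa [Real.dist_0_eq_abs, abs_of_nonneg ht0])
    have himg := image_ball_add_smul_sub hr hρ h hid ht0 ht1 fun x hx => (hp x hx).ne'
    have hinj : InjOn (fun x => x + t • (r x - x)) (ball 0 ρ) := by
      intro x hx y hy hxy
      have hxy' : x - y = t • (g y - g x) := by
        simp only [g]
        have : x + t • (r x - x) = y + t • (r y - y) := hxy
        rw [sub_eq_iff_eq_add]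
        have h2 : x = y + t • (r y - y) - t • (r x - x) := by rw [← this]; abel
        rw [smul_sub t (r y - y)]
        nth_rw 1 [h2]
        abel
      have hl : ‖g y - g x‖ ≤ c * ‖y - x‖ :=
        (convex_closedBall (0 : E) ρ).norm_image_sub_le_of_norm_fderiv_le (𝕜 := ℝ)
          (fun z _ => (hg.differentiable one_ne_zero) z) hc
          (ball_subset_closedBall hx) (ball_subset_closedBall hy)
      by_contra hne
      have hn : 0 < ‖x - y‖ := norm_pos_iff.2 (sub_ne_zero.2 hne)
      have : ‖x - y‖ ≤ |t| * c * ‖x - y‖ := by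
        calc ‖x - y‖ = |t| * ‖g y - g x‖ := by rw [hxy', norm_smul, Real.norm_eq_abs]
          _ ≤ |t| * (c * ‖y - x‖) := by gcongr
          _ = |t| * c * ‖x - y‖ := by rw [norm_sub_rev]; ring
      nlinarith
    have hcv := integral_image_eq_integral_abs_det_fderiv_smul volume
      (f := fun x => x + t • (r x - x)) (f' := fun x => 1 + t • fderiv ℝ g x)
      measurableSet_ball (fun x _ => ((hasFDerivAt_id x).add
        (((hg.differentiable one_ne_zero) x).hasFDerivAt.const_smul t)).hasFDerivWithinAt)
      hinj (fun _ => (1 : ℝ))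
    rw [himg] at hcv
    simp only [smul_eq_mul, mul_one, integral_const, measureReal_restrict_apply_univ] at hcv
    rw [hcv]
    exact setIntegral_congr_fun measurableSet_ball fun x hx =>
      (abs_of_pos (hp x (ball_subset_closedBall hx))).symm
  classical
  -- One node more than the degree bound of the determinant polynomial. The nodes `δ * (i / N)` are
  -- distinct and lie in `[0, δ)`, where `key` applies.
  let N := Module.finrank ℝ E + 1
  let δ := min ε 1
  have hδ : 0 < δ := lt_min hε one_pos
  let v : Fin N → ℝ := fun i => δ * ((i : ℕ) / N)
  have hN : (0 : ℝ) < N := by positivity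
  have hv0 : ∀ i, 0 ≤ v i := fun i => by positivity
  have hvδ : ∀ i, v i < δ := fun i => by
    have : ((i : ℕ) : ℝ) / N < 1 := (div_lt_one hN).2 (by exact_mod_cast i.2)
    simpa using mul_lt_mul_of_pos_left this hδ
  have hvinj : InjOn v (Finset.univ : Finset (Fin N)) := by
    intro i _ j _ hij
    have : ((i : ℕ) : ℝ) / N = (j : ℕ) / N := mul_left_cancel₀ hδ.ne' hij
    rw [div_left_inj' hN.ne'] at this
    exact Fin.ext (by exact_mod_cast this)
  -- The interpolation weights do not depend on `x` and sum to `1`, so the constancy of the integral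
  -- for small `t` carries over to `t = 1`. There the determinant is that of the derivative of `r`,
  -- which vanishes.
  have hlag : ∀ x, (1 + (1 : ℝ) • fderiv ℝ g x).det =
      ∑ i, (1 + v i • fderiv ℝ g x).det * (Lagrange.basis Finset.univ v i).eval 1 := by
    intro x
    obtain ⟨p, hp, hpe⟩ := exists_polynomial_eval_eq_det_one_add_smul (fderiv ℝ g x)
    have := Lagrange.eq_interpolate (s := Finset.univ) (v := v) hvinj (f := p) (by simpa [N] using hp)
    rw [← hpe 1]
    conv_lhs => rw [this]
    simp [Lagrange.interpolate_apply, Polynomial.eval_finsetSum, hpe]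
  have hint : ∀ t : ℝ, IntegrableOn (fun x => (1 + t • fderiv ℝ g x).det) (ball (0 : E) ρ) := by
    intro t
    have : Continuous fun x => (1 + t • fderiv ℝ g x).det :=
      hdetc.comp (continuous_const.prodMk continuous_id)
    exact (this.continuousOn.integrableOn_compact hK).mono_set ball_subset_closedBall
  have h1 : ∫ x in ball (0 : E) ρ, (1 + (1 : ℝ) • fderiv ℝ g x).det =
      volume.real (ball (0 : E) ρ) := by
    simp_rw [hlag]
    rw [integral_finsetSum _ fun i _ => (hint (v i)).mul_const _]
    simp_rw [integral_mul_const]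
    rw [Finset.sum_congr rfl fun i _ => by
      rw [key (v i) (hv0 i) ((hvδ i).trans_le (min_le_left _ _))
        ((hvδ i).trans_le (min_le_right _ _))], ← Finset.mul_sum, ← Polynomial.eval_finsetSum,
      Lagrange.sum_basis hvinj ⟨0, Finset.mem_univ _⟩]
    simp
  have h0 : ∀ x, (1 + (1 : ℝ) • fderiv ℝ g x).det = 0 := by
    intro x
    rw [← det_fderiv_eq_zero_of_norm_eq (hr.differentiable one_ne_zero) hρ h x]
    congr 1
    have : fderiv ℝ g x = fderiv ℝ r x - 1 := by
      have := fderiv_fun_sub (𝕜 := ℝ) ((hr.differentiable one_ne_zero) x) differentiableAt_id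
      simpa [g, ContinuousLinearMap.one_def] using this
    rw [this, one_smul]
    abel
  simp only [h0, integral_zero] at h1
  have := (measure_ball_pos volume (0 : E) hρ).ne'
  rw [eq_comm, measureReal_eq_zero_iff measure_ball_lt_top.ne] at h1
  exact this h1

/-- **Brouwer's fixed point theorem**, for maps of the whole space into the closed unit ball. -/
theorem exists_fixedPoint_of_norm_le_one {f : E → E} (hf : Continuous f)
    (hf1 : ∀ x, ‖f x‖ ≤ 1) : ∃ x, f x = x := by
  by_contra! hne
  -- The cutoff is `1` on the unit ball and `0` beyond radius `2`. It creates no fixed point, since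
  -- a fixed point of `F` has norm at most `1`.
  let c : E → ℝ := fun x => max 0 (min 1 (2 - ‖x‖))
  have hc : Continuous c := by fun_prop
  let F : E → E := fun x => c x • f x
  have hF : Continuous F := by fun_prop
  have hF2 : ∀ x, 2 ≤ ‖x‖ → F x = 0 := fun x hx => by
    have : c x = 0 := max_eq_left (min_le_of_right_le (by linarith))
    simp [F, this]
  have hφ : ∀ x, 0 < ‖x - F x‖ := by
    intro x
    rw [norm_pos_iff, sub_ne_zero]
    intro hx
    rcases le_or_gt ‖x‖ 1 with h1 | h1
    · have : c x = 1 := by simp only [c]; rw [min_eq_left (by linarith), max_eq_right zero_le_one]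
      simp only [F, this, one_smul] at hx
      exact hne x hx.symm
    · have : ‖F x‖ ≤ 1 := by
        have h0 : 0 ≤ c x := le_max_left _ _
        have h2 : c x ≤ 1 := max_le zero_le_one (min_le_left _ _)
        rw [norm_smul, Real.norm_of_nonneg h0]
        nlinarith [hf1 x, norm_nonneg (f x)]
      rw [← hx] at this
      linarith
  obtain ⟨x₀, -, hx₀⟩ := (isCompact_closedBall (0 : E) 2).exists_isMinOn
    ⟨0, by simp⟩ (f := fun x => ‖x - F x‖) (by fun_prop)
  -- An error below the minimal displacement of `F` on the ball keeps `G` free of fixed points. `G`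
  -- also vanishes where `F` does, so normalizing `x - G x` to length `2` fixes the sphere of radius
  -- `2`.
  obtain ⟨G, hG, hGF, hsupp⟩ := hF.exists_contDiff_approx 1
    (continuous_const (y := ‖x₀ - F x₀‖)) fun _ => hφ x₀
  have hG2 : ∀ x, 2 ≤ ‖x‖ → G x = 0 := fun x hx => by
    by_contra h
    exact hsupp h (hF2 x hx)
  have hψ : ∀ x, x - G x ≠ 0 := by
    intro x hx
    rcases le_or_gt 2 ‖x‖ with h2 | h2
    · rw [hG2 x h2, sub_zero] at hx
      rw [hx, norm_zero] at h2
      linarith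
    · have h3 := hx₀ (show x ∈ closedBall (0 : E) 2 by simpa using h2.le)
      have h4 := hGF x
      rw [← sub_eq_zero.1 hx, dist_eq_norm] at h4
      simp only [mem_ofPred_eq] at h3
      linarith
  have hψd : ContDiff ℝ 1 fun x => x - G x := contDiff_id.sub hG
  let r : E → E := fun x => (2 / ‖x - G x‖) • (x - G x)
  have hr : ContDiff ℝ 1 r :=
    (contDiff_const.div (hψd.norm ℝ hψ) fun x => norm_ne_zero_iff.2 (hψ x)).smul hψd
  obtain ⟨x, hx, hrx⟩ := not_exists_smooth_retraction_sphere hr two_pos fun x => by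
    simp only [r]
    rw [norm_smul, norm_div, norm_norm, Real.norm_of_nonneg zero_le_two,
      div_mul_cancel₀ _ (norm_ne_zero_iff.2 (hψ x))]
  exact hrx (by simp [r, hG2 x hx.ge, hx])

omit [FiniteDimensional ℝ E] in
lemma continuous_max_one_norm_inv_smul :
    Continuous fun x : E => (max 1 ‖x‖)⁻¹ • x :=
  (Continuous.inv₀ (by fun_prop) fun x => (lt_max_of_lt_left one_pos).ne').smul continuous_id

omit [FiniteDimensional ℝ E] in
lemma norm_max_one_norm_inv_smul_le (x : E) : ‖(max 1 ‖x‖)⁻¹ • x‖ ≤ 1 := by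
  have h : 0 < max 1 ‖x‖ := lt_max_of_lt_left one_pos
  rw [norm_smul, norm_inv, Real.norm_of_nonneg h.le, inv_mul_le_iff₀ h, mul_one]
  exact le_max_right _ _

/-- If `G` is a left inverse of an embedding `f` of the closed unit ball, then every continuous
function on the image close to `G` has a zero. -/
lemma exists_zero_of_norm_sub_le_one {f G G' : E → E} (hf : ContinuousOn f (closedBall 0 1))
    (hG : ∀ x ∈ closedBall (0 : E) 1, G (f x) = x)
    (hG' : ContinuousOn G' (f '' closedBall 0 1))
    (h : ∀ y ∈ f '' closedBall 0 1, ‖G y - G' y‖ ≤ 1) :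
    ∃ y ∈ f '' closedBall 0 1, G' y = 0 := by
  let p : E → E := fun x => (max 1 ‖x‖)⁻¹ • x
  have hp : Continuous p := continuous_max_one_norm_inv_smul
  have hpB : ∀ x, p x ∈ closedBall (0 : E) 1 := fun x =>
    mem_closedBall_zero_iff.2 (norm_max_one_norm_inv_smul_le x)
  have hfp : Continuous fun x => f (p x) := hf.comp_continuous hp hpB
  have hGfp : Continuous fun x => G' (f (p x)) :=
    hG'.comp_continuous hfp fun x => mem_image_of_mem f (hpB x)
  have hle : ∀ x, ‖p x - G' (f (p x))‖ ≤ 1 := fun x => by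
    have := h _ (mem_image_of_mem f (hpB x))
    rwa [hG _ (hpB x)] at this
  -- A fixed point has norm at most `1`, so `p x = x`, and `x - G' (f x) = x` exhibits the zero.
  obtain ⟨x, hx⟩ := exists_fixedPoint_of_norm_le_one (hp.sub hGfp) hle
  have hx1 : ‖x‖ ≤ 1 := by rw [← hx]; exact hle x
  have hpx : p x = x := by simp [p, max_eq_left hx1]
  refine ⟨f (p x), mem_image_of_mem f (hpB x), ?_⟩
  rw [Pi.sub_apply, hpx] at hx
  rw [hpx]
  simpa using hx

/-- Extend the inverse of `f` to a continuous `G`, whose only zero on the image is `f 0`. If `f 0`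
were not interior, there would be points `c` near it off the image. Pushing the image away from `c`
onto a small sphere, and replacing `G` by a smooth approximation without zeros on that sphere, gives
a zero-free function close to `G` on the image. This contradicts `exists_zero_of_norm_sub_le_one`.
-/
lemma mem_interior_image_closedBall {f : E → E} (hf : ContinuousOn f (closedBall 0 1))
    (hinj : InjOn f (closedBall 0 1)) : f 0 ∈ interior (f '' closedBall 0 1) := by
  by_contra hint
  let _ : MeasurableSpace E := borel E
  have : BorelSpace E := ⟨rfl⟩
  set B := closedBall (0 : E) 1 with hB
  have hBc : IsCompact B := isCompact_closedBall _ _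
  have : CompactSpace B := isCompact_iff_compactSpace.1 hBc
  have hK : IsCompact (f '' B) := hBc.image_of_continuousOn hf
  have hemb : IsClosedEmbedding fun x : B => f x :=
    (continuousOn_iff_continuous_domRestrict.1 hf).isClosedEmbedding
      fun x y hxy => Subtype.ext (hinj x.2 y.2 hxy)
  obtain ⟨G, hG'⟩ := ContinuousMap.exists_extension hemb (⟨Subtype.val, continuous_subtype_val⟩ :
    C(B, E))
  have hG : ∀ x ∈ B, G (f x) = x := fun x hx => congrArg (fun h : C(B, E) => h ⟨x, hx⟩) hG'
  have h0B : (0 : E) ∈ B := by simp [hB]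
  obtain ⟨η, hη, hGη⟩ := Metric.continuousAt_iff.1 (G.continuous.continuousAt (x := f 0)) (1 / 10)
    (by norm_num)
  -- The radius is halved so that, for `c` within `δ` of `f 0`, the closed `δ`-ball around `c` stays
  -- where `‖G‖ < 1 / 10`.
  obtain ⟨δ, hδ, rfl⟩ : ∃ δ > 0, η = 2 * δ := ⟨η / 2, by linarith, by ring⟩
  have hGη' : ∀ y, dist y (f 0) < 2 * δ → ‖G y‖ < 1 / 10 := fun y hy => by
    simpa [hG 0 h0B] using hGη hy
  obtain ⟨c, hcK, hc⟩ : ∃ c, c ∉ f '' B ∧ dist c (f 0) < δ := by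
    by_contra! h
    refine hint (mem_interior_iff_mem_nhds.2 (Metric.mem_nhds_iff.2 ⟨δ, hδ, fun y hy => ?_⟩))
    by_contra hy'
    exact absurd hy (not_lt.2 (h y hy'))
  have hfar : IsCompact (f '' B ∩ {y | δ ≤ ‖y - c‖}) :=
    hK.inter_right (isClosed_le continuous_const (by fun_prop))
  have hfar0 : ∀ y ∈ f '' B ∩ {y | δ ≤ ‖y - c‖}, 0 < ‖G y‖ := by
    rintro _ ⟨⟨x, hx, rfl⟩, hxc⟩
    rw [hG x hx, norm_pos_iff]
    rintro rfl
    rw [dist_comm, dist_eq_norm] at hc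
    exact absurd hc (not_lt.2 hxc)
  obtain ⟨ε, hε, hεfar⟩ : ∃ ε > 0, ∀ y ∈ f '' B ∩ {y | δ ≤ ‖y - c‖}, ε ≤ ‖G y‖ :=
    hfar.exists_forall_le' (G.continuous.norm.continuousOn) hfar0
  let μ := min ε (1 / 10)
  have hμ : 0 < μ := lt_min hε (by norm_num)
  obtain ⟨P₀, hP₀, hP₀G, -⟩ := G.continuous.exists_contDiff_approx 1
    (continuous_const (y := μ / 2)) fun _ => half_pos hμ
  -- The smooth image of a sphere is null, so an arbitrarily small translation `a` removes all zeros
  -- on the sphere.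
  have hnull : volume (P₀ '' sphere c δ) = 0 :=
    addHaar_image_eq_zero_of_differentiableOn_of_addHaar_eq_zero volume
      (hP₀.differentiable one_ne_zero).differentiableOn
      (Measure.addHaar_sphere_of_ne_zero volume c hδ.ne')
  obtain ⟨a, ha, haP⟩ : ∃ a ∈ ball (0 : E) (μ / 2), a ∉ P₀ '' sphere c δ := by
    by_contra! h
    exact (measure_ball_pos volume (0 : E) (half_pos hμ)).ne'
      (measure_mono_null (fun a ha => h a ha) hnull)
  let P : E → E := fun y => P₀ y - a
  have hPc : Continuous P := hP₀.continuous.sub continuous_const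
  have hPG : ∀ y, ‖G y - P y‖ < μ := fun y => by
    have h1 := hP₀G y
    rw [dist_comm, dist_eq_norm] at h1
    rw [mem_ball_zero_iff] at ha
    have : G y - P y = (G y - P₀ y) + a := by simp only [P]; abel
    rw [this]
    linarith [norm_add_le (G y - P₀ y) a]
  -- Points of the image within `δ` of `c` are pushed radially onto the sphere and the others are
  -- fixed. This is continuous on the image because `c` is not in it.
  let Φ : E → E := fun y => c + max 1 (δ / ‖y - c‖) • (y - c)
  have hne : ∀ y ∈ f '' B, ‖y - c‖ ≠ 0 := fun y hy h => hcK (by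
    rw [norm_eq_zero, sub_eq_zero] at h
    rwa [← h])
  have hΦ : ContinuousOn Φ (f '' B) := by
    refine continuousOn_const.add (ContinuousOn.smul ?_ (by fun_prop))
    exact ContinuousOn.sup continuousOn_const (continuousOn_const.div (by fun_prop) hne)
  have hΦ1 : ∀ y ∈ f '' B, δ ≤ ‖y - c‖ → Φ y = y := fun y hy h => by
    have : δ / ‖y - c‖ ≤ 1 := div_le_one_of_le₀ h (norm_nonneg _)
    simp [Φ, max_eq_left this]
  have hΦ2 : ∀ y ∈ f '' B, ‖y - c‖ < δ → Φ y ∈ sphere c δ := fun y hy h => by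
    have hpos : 0 < ‖y - c‖ := lt_of_le_of_ne (norm_nonneg _) (hne y hy).symm
    have : 1 ≤ δ / ‖y - c‖ := (one_le_div hpos).2 h.le
    rw [mem_sphere_iff_norm]
    simp only [Φ, max_eq_right this, add_sub_cancel_left]
    rw [norm_smul, norm_div, norm_norm, Real.norm_of_nonneg hδ.le, div_mul_cancel₀ _ hpos.ne']
  obtain ⟨y, hy, hy0⟩ := exists_zero_of_norm_sub_le_one (G' := fun y => P (Φ y)) hf hG
    (hPc.comp_continuousOn hΦ) fun y hy => by
      rcases le_or_gt δ ‖y - c‖ with h | h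
      · rw [hΦ1 y hy h]
        exact ((hPG y).le.trans (min_le_right _ _)).trans (by norm_num)
      · have h1 : ‖G y‖ < 1 / 10 := hGη' y (by
          rw [← dist_eq_norm] at h
          linarith [dist_triangle y c (f 0)])
        have h2 : ‖G (Φ y)‖ < 1 / 10 := hGη' _ (by
          have := mem_sphere.1 (hΦ2 y hy h)
          linarith [dist_triangle (Φ y) c (f 0)])
        have h3 : ‖G (Φ y) - P (Φ y)‖ < 1 / 10 := (hPG _).trans_le (min_le_right _ _)
        have h4 : G y - P (Φ y) = G y - G (Φ y) + (G (Φ y) - P (Φ y)) := by abel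
        rw [h4]
        linarith [norm_add_le (G y - G (Φ y)) (G (Φ y) - P (Φ y)), norm_sub_le (G y) (G (Φ y))]
  rcases le_or_gt δ ‖y - c‖ with h | h
  · rw [hΦ1 y hy h] at hy0
    have h1 := hεfar y ⟨hy, h⟩
    have h2 := (hPG y).trans_le (min_le_left _ _)
    rw [hy0, sub_zero] at h2
    linarith
  · exact haP ⟨Φ y, hΦ2 y hy h, sub_eq_zero.1 hy0⟩

lemma isOpen_image_of_continuousOn_injOn_of_innerProductSpace {f : E → E} {U : Set E}
    (hU : IsOpen U) (hf : ContinuousOn f U) (hinj : InjOn f U) : IsOpen (f '' U) := by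
  rw [isOpen_iff_mem_nhds]
  rintro _ ⟨x, hx, rfl⟩
  obtain ⟨ε, hε, hball⟩ := Metric.nhds_basis_closedBall.mem_iff.1 (hU.mem_nhds hx)
  have hmaps : MapsTo (fun z : E => x + ε • z) (closedBall 0 1) U := fun z hz => hball (by
    rw [mem_closedBall_zero_iff] at hz
    rw [mem_closedBall_iff_norm, add_sub_cancel_left, norm_smul, Real.norm_of_nonneg hε.le]
    nlinarith)
  have := mem_interior_image_closedBall (f := fun z => f (x + ε • z))
    (hf.comp (by fun_prop) hmaps) fun z hz w hw hzw => by
      simpa [hε.ne'] using hinj (hmaps hz) (hmaps hw) hzw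
  rw [mem_interior_iff_mem_nhds] at this
  simp only [smul_zero, add_zero] at this
  refine mem_of_superset this ?_
  rintro _ ⟨z, hz, rfl⟩
  exact mem_image_of_mem f (hmaps hz)

section FiniteDimensional

variable {V W : Type*} [NormedAddCommGroup V] [NormedSpace ℝ V] [FiniteDimensional ℝ V]
  [NormedAddCommGroup W] [NormedSpace ℝ W] [FiniteDimensional ℝ W]

/-- **Invariance of domain**: a continuous injective map from an open subset of a
finite-dimensional space to a space of at most the same dimension is open. -/
theorem isOpen_image_of_continuousOn_injOn (hVW : Module.finrank ℝ W ≤ Module.finrank ℝ V)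
    {f : V → W} {U : Set V} (hU : IsOpen U) (hf : ContinuousOn f U) (hinj : InjOn f U) :
    IsOpen (f '' U) := by
  let E := EuclideanSpace ℝ (Fin (Module.finrank ℝ V))
  let e : E ≃L[ℝ] V := ContinuousLinearEquiv.ofFinrankEq (by simp [E])
  obtain ⟨j, hj⟩ : ∃ j : W →ₗ[ℝ] E, Function.Injective j :=
    finrank_le_iff_exists_linearMap.1 (by simpa [E] using hVW)
  have hjc : Continuous j := j.continuous_of_finiteDimensional
  have hopen := isOpen_image_of_continuousOn_injOn_of_innerProductSpace
    (f := fun x : E => j (f (e x))) (U := e ⁻¹' U) (hU.preimage e.continuous)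
    (hjc.comp_continuousOn (hf.comp e.continuous.continuousOn (mapsTo_preimage _ _)))
    fun x hx y hy hxy => e.injective (hinj hx hy (hj hxy))
  convert hopen.preimage hjc using 1
  ext w
  constructor
  · rintro ⟨x, hx, rfl⟩
    exact ⟨e.symm x, by simpa using hx, by simp⟩
  · rintro ⟨x, hx, hxw⟩
    exact ⟨e x, hx, hj hxw⟩

/-- **Invariance of dimension.** -/
theorem finrank_le_of_continuousOn_injOn {f : V → W} {U : Set V} (hU : IsOpen U)
    (hne : U.Nonempty) (hf : ContinuousOn f U) (hinj : InjOn f U) :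
    Module.finrank ℝ V ≤ Module.finrank ℝ W := by
  by_contra! hlt
  -- If `W` had smaller dimension, `W × ℝ` would still be small enough for invariance of domain, yet
  -- the open image lies in the hyperplane `W × {0}`.
  have hopen := isOpen_image_of_continuousOn_injOn (W := W × ℝ) (f := fun x => (f x, (0 : ℝ)))
    (by simpa using hlt) hU (hf.prodMk continuousOn_const)
    fun x hx y hy hxy => hinj hx hy (congrArg Prod.fst hxy)
  obtain ⟨x, hx⟩ := hne
  have hnhds : ∀ᶠ t : ℝ in 𝓝 0, (f x, t) ∈ (fun x => (f x, (0 : ℝ))) '' U :=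
    (Continuous.prodMk_right (f x)).continuousAt.eventually
      (hopen.mem_nhds (mem_image_of_mem _ hx))
  have h0 : ∀ᶠ t : ℝ in 𝓝 0, t = 0 := hnhds.mono fun t ⟨y, _, hy⟩ => (congrArg Prod.snd hy).symm
  obtain ⟨ε, hε, h⟩ := Metric.eventually_nhds_iff.1 h0
  have := h (y := ε / 2) (by rw [Real.dist_0_eq_abs, abs_of_pos (half_pos hε)]; linarith)
  linarith

end FiniteDimensional

end Brouwer

/-! ### Boundaries of cells in finite regular complexes -/

section RegularComplex

open Metric Set

universe u

variable {X : Type u} [TopologicalSpace X] {C : Set X} [CWComplex C]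

namespace Ent

/-- The open cell of an object of the entrance path category. -/
def openCell (x : Ent C) : Set X := RelCWComplex.openCell x.dim x.index

/-- The closed cell of an object of the entrance path category. -/
def closedCell (x : Ent C) : Set X := RelCWComplex.closedCell x.dim x.index

/-- The boundary of the cell of an object of the entrance path category. -/
def boundary (x : Ent C) : Set X := RelCWComplex.cellFrontier x.dim x.index

lemma boundary_union_openCell (x : Ent C) : x.boundary ∪ x.openCell = x.closedCell :=
  RelCWComplex.cellFrontier_union_openCell_eq_closedCell x.dim x.index

lemma openCell_subset_closedCell (x : Ent C) : x.openCell ⊆ x.closedCell :=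
  RelCWComplex.openCell_subset_closedCell x.dim x.index

lemma boundary_subset_closedCell (x : Ent C) : x.boundary ⊆ x.closedCell :=
  RelCWComplex.cellFrontier_subset_closedCell x.dim x.index

lemma openCell_nonempty (x : Ent C) : x.openCell.Nonempty :=
  RelCWComplex.openCell_nonempty x.dim x.index

lemma eq_of_mem_openCell {x y : Ent C} {p : X} (hx : p ∈ x.openCell) (hy : p ∈ y.openCell) :
    x = y := by
  have := RelCWComplex.eq_of_not_disjoint_openCell
    (not_disjoint_iff.2 ⟨p, hx, hy⟩ : ¬ Disjoint (RelCWComplex.openCell x.dim x.index)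
      (RelCWComplex.openCell y.dim y.index))
  obtain ⟨n, i⟩ := x
  obtain ⟨m, j⟩ := y
  cases this
  rfl

lemma exists_mem_openCell {p : X} (hp : p ∈ C) : ∃ x : Ent C, p ∈ x.openCell := by
  rw [← CWComplex.iUnion_openCell_eq_complex (C := C)] at hp
  obtain ⟨n, i, h⟩ := by simpa using hp
  exact ⟨⟨n, i⟩, h⟩

lemma closedCell_subset (x : Ent C) : x.closedCell ⊆ C :=
  RelCWComplex.closedCell_subset_complex x.dim x.index

lemma exists_dim_lt_of_mem_boundary {x : Ent C} {p : X} (hp : p ∈ x.boundary) :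
    ∃ y : Ent C, y.dim < x.dim ∧ p ∈ y.openCell := by
  obtain ⟨I, hI⟩ := CWComplex.cellFrontier_subset_finite_openCell x.dim x.index
  obtain ⟨m, hm, j, -, h⟩ := by simpa using hI hp
  exact ⟨⟨m, j⟩, hm, h⟩

lemma dim_lt_of_mem {x y : Ent C} {p : X} (hp : p ∈ x.boundary) (hy : p ∈ y.openCell) :
    y.dim < x.dim := by
  obtain ⟨z, hz, hpz⟩ := exists_dim_lt_of_mem_boundary hp
  rwa [eq_of_mem_openCell hy hpz]

lemma StrictFace.dim_lt {x y : Ent C} (h : StrictFace x y) : y.dim < x.dim := by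
  obtain ⟨p, hp⟩ := y.openCell_nonempty
  exact dim_lt_of_mem (h (y.openCell_subset_closedCell hp)) hp

lemma StrictFace.trans {x y z : Ent C} (h : StrictFace x y) (h' : StrictFace y z) :
    StrictFace x z :=
  (Subset.trans h' y.boundary_subset_closedCell).trans h

/-- The cells of a complex, ordered so that the entrance paths are the strictly increasing
sequences. -/
instance : PartialOrder (Ent C) where
  le x y := x = y ∨ StrictFace x y
  le_refl x := Or.inl rfl
  le_trans x y z := by
    rintro (rfl | h) (rfl | h')
    · exact Or.inl rfl
    · exact Or.inr h'
    · exact Or.inr h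
    · exact Or.inr (h.trans h')
  le_antisymm x y := by
    rintro (rfl | h) (h' | h')
    · rfl
    · rfl
    · exact h'.symm
    · exact absurd (h.dim_lt.trans h'.dim_lt) (lt_irrefl _)

lemma le_iff_eq_or_strictFace {x y : Ent C} : x ≤ y ↔ x = y ∨ StrictFace x y := Iff.rfl

lemma lt_iff_strictFace {x y : Ent C} : x < y ↔ StrictFace x y := by
  rw [lt_iff_le_and_ne, le_iff_eq_or_strictFace]
  refine ⟨fun h => h.1.resolve_left h.2, fun h => ⟨Or.inr h, ?_⟩⟩
  rintro rfl
  exact lt_irrefl _ h.dim_lt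

instance [CWComplex.Finite C] : Finite (Ent C) := by
  have : Finite (Σ n, RelCWComplex.cell C n) := RelCWComplex.finite_cells_of_finite
  exact Finite.of_injective (fun x : Ent C => (⟨x.dim, x.index⟩ : Σ n, RelCWComplex.cell C n))
    fun ⟨n, i⟩ ⟨m, j⟩ h => by cases h; rfl

/-- The interior coordinates of an open cell. -/
def coords (x : Ent C) : X → Fin x.dim → ℝ := (RelCWComplex.map x.dim x.index).symm

lemma continuousOn_coords (x : Ent C) : ContinuousOn x.coords x.openCell := by
  have := RelCWComplex.continuousOn_symm x.dim x.index
  rwa [← PartialEquiv.image_source_eq_target, RelCWComplex.source_eq] at this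

lemma map_coords (x : Ent C) {p : X} (hp : p ∈ x.openCell) :
    RelCWComplex.map x.dim x.index (x.coords p) = p := by
  refine (RelCWComplex.map x.dim x.index).right_inv ?_
  rwa [← PartialEquiv.image_source_eq_target, RelCWComplex.source_eq]

lemma coords_map (x : Ent C) {v : Fin x.dim → ℝ} (hv : v ∈ ball (0 : Fin x.dim → ℝ) 1) :
    x.coords (RelCWComplex.map x.dim x.index v) = v := by
  refine (RelCWComplex.map x.dim x.index).left_inv ?_
  rwa [RelCWComplex.source_eq]

lemma coords_mem_ball (x : Ent C) {p : X} (hp : p ∈ x.openCell) :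
    x.coords p ∈ ball (0 : Fin x.dim → ℝ) 1 := by
  obtain ⟨v, hv, rfl⟩ := hp
  rwa [coords_map x hv]

lemma injOn_coords (x : Ent C) : InjOn x.coords x.openCell :=
  fun p hp q hq h => by rw [← x.map_coords hp, ← x.map_coords hq, h]

lemma closedCell_subset_closure (x : Ent C) : x.closedCell ⊆ closure x.openCell := by
  have h := RelCWComplex.continuousOn x.dim x.index
  rw [← closure_ball (0 : Fin x.dim → ℝ) one_ne_zero] at h
  have := h.image_closure
  rwa [closure_ball (0 : Fin x.dim → ℝ) one_ne_zero] at this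

/-- Extending a relatively open piece of an embedded sphere which lies in an open cell radially
gives an injective map between open subsets of Euclidean spaces. -/
lemma finrank_and_isOpen_of_sphere {n : ℕ} {φ : (Fin n → ℝ) → X}
    (hφ : ContinuousOn φ (sphere 0 1)) (hinj : InjOn φ (sphere 0 1)) {O : Set X} (hO : IsOpen O)
    {y : Ent C} (hy : φ '' sphere 0 1 ∩ O ⊆ y.openCell) :
    ((φ '' sphere 0 1 ∩ O).Nonempty → n ≤ y.dim + 1) ∧
      (y.dim + 1 ≤ n → IsOpen (y.coords '' (φ '' sphere 0 1 ∩ O))) := by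
  let d : (Fin n → ℝ) → Fin n → ℝ := fun v => ‖v‖⁻¹ • v
  have hd : ContinuousOn d {v | v ≠ 0} :=
    ContinuousOn.smul (continuousOn_id.norm.inv₀ fun v hv => norm_ne_zero_iff.2 hv)
      continuousOn_id
  have hds : MapsTo d {v | v ≠ 0} (sphere 0 1) := fun v hv => by
    rw [mem_sphere_zero_iff_norm, norm_smul, norm_inv, norm_norm,
      inv_mul_cancel₀ (norm_ne_zero_iff.2 hv)]
  have hd1 : ∀ v ∈ sphere (0 : Fin n → ℝ) 1, d v = v := fun v hv => by
    simp [d, mem_sphere_zero_iff_norm.1 hv]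
  have hφd : ContinuousOn (fun v => φ (d v)) {v | v ≠ 0} := hφ.comp hd hds
  let U : Set (Fin n → ℝ) := {v | v ≠ 0} ∩ (fun v => φ (d v)) ⁻¹' O
  have hU : IsOpen U := hφd.isOpen_inter_preimage isOpen_ne hO
  have hUV : ∀ v ∈ U, φ (d v) ∈ φ '' sphere 0 1 ∩ O := fun v hv =>
    ⟨mem_image_of_mem φ (hds hv.1), hv.2⟩
  -- The norm is kept as an extra coordinate: this makes the radial extension injective, and the
  -- slice at norm `1` gives back the piece of the sphere.
  let F : (Fin n → ℝ) → (Fin y.dim → ℝ) × ℝ := fun v => (y.coords (φ (d v)), ‖v‖)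
  have hF : ContinuousOn F U :=
    (y.continuousOn_coords.comp (hφd.mono inter_subset_left) fun v hv => hy (hUV v hv)).prodMk
      continuousOn_id.norm
  have hFinj : InjOn F U := fun v hv w hw h => by
    have h1 := hinj (hds hv.1) (hds hw.1)
      (y.injOn_coords (hy (hUV v hv)) (hy (hUV w hw)) (congrArg Prod.fst h))
    have h2 : ‖v‖ = ‖w‖ := congrArg Prod.snd h
    simp only [d, h2] at h1
    exact smul_right_injective _ (inv_ne_zero (norm_ne_zero_iff.2 hw.1)) h1
  constructor
  · rintro ⟨_, ⟨v, hv, rfl⟩, hvO⟩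
    have hvU : v ∈ U := by
      refine ⟨ne_zero_of_mem_unit_sphere ⟨v, hv⟩, ?_⟩
      rwa [mem_preimage, hd1 v hv]
    simpa using finrank_le_of_continuousOn_injOn hU ⟨v, hvU⟩ hF hFinj
  · intro hn
    have hopen := isOpen_image_of_continuousOn_injOn (by simpa using hn) hU hF hFinj
    suffices h : y.coords '' (φ '' sphere 0 1 ∩ O) = (fun z => (z, (1 : ℝ))) ⁻¹' (F '' U) by
      rw [h]
      exact hopen.preimage (Continuous.prodMk_left (1 : ℝ))
    ext z
    constructor
    · rintro ⟨_, ⟨⟨v, hv, rfl⟩, hvO⟩, rfl⟩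
      refine ⟨v, ⟨ne_zero_of_mem_unit_sphere ⟨v, hv⟩, ?_⟩, ?_⟩
      · rwa [mem_preimage, hd1 v hv]
      · simp only [F, hd1 v hv, mem_sphere_zero_iff_norm.1 hv]
    · rintro ⟨v, hv, hvz⟩
      exact ⟨φ (d v), hUV v hv, congrArg Prod.fst hvz⟩

variable [T2Space X]

lemma isClosed_closedCell (x : Ent C) : IsClosed x.closedCell :=
  RelCWComplex.isClosed_closedCell

lemma isClosed_boundary (x : Ent C) : IsClosed x.boundary :=
  RelCWComplex.isClosed_cellFrontier

-- The trace of `A` on the cell is closed, and by assumption open in coordinates. The coordinate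
-- ball is connected.
omit [T2Space X] in
lemma openCell_subset_of_isOpen_coords_image {A : Set X} (hA : IsClosed A) {y : Ent C}
    (hne : (A ∩ y.openCell).Nonempty) (hopen : IsOpen (y.coords '' (A ∩ y.openCell))) :
    y.openCell ⊆ A := by
  have hc : ContinuousOn (RelCWComplex.map y.dim y.index) (ball 0 1) :=
    (RelCWComplex.continuousOn y.dim y.index).mono ball_subset_closedBall
  have hmem : ∀ v ∈ ball (0 : Fin y.dim → ℝ) 1, RelCWComplex.map y.dim y.index v ∈ y.openCell :=
    fun v hv => mem_image_of_mem _ hv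
  have hsub : ball (0 : Fin y.dim → ℝ) 1 ⊆ y.coords '' (A ∩ y.openCell) := by
    refine IsPreconnected.subset_left_of_subset_union hopen
      (hc.isOpen_inter_preimage isOpen_ball hA.isOpen_compl) ?_ ?_ ?_
      (convex_ball (0 : Fin y.dim → ℝ) 1).isPreconnected
    · rw [Set.disjoint_left]
      rintro _ ⟨p, hp, rfl⟩ ⟨-, h⟩
      rw [mem_preimage, y.map_coords hp.2] at h
      exact h hp.1
    · intro v hv
      by_cases h : RelCWComplex.map y.dim y.index v ∈ A
      · exact Or.inl ⟨_, ⟨h, hmem v hv⟩, y.coords_map hv⟩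
      · exact Or.inr ⟨hv, h⟩
    · obtain ⟨p, hp⟩ := hne
      exact ⟨_, y.coords_mem_ball hp.2, mem_image_of_mem _ hp⟩
  intro p hp
  obtain ⟨q, hq, hqp⟩ := hsub (y.coords_mem_ball hp)
  rw [← y.injOn_coords hq.2 hp hqp]
  exact hq.1

-- The boundary of a cell meets only open cells of smaller dimension, and distinct open cells are
-- disjoint.
omit [T2Space X] in
lemma notMem_closedCell_of_dim_le {y z : Ent C} (hne : z ≠ y) (hdim : z.dim ≤ y.dim) {p : X}
    (hp : p ∈ y.openCell) : p ∉ z.closedCell := by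
  rw [← boundary_union_openCell]
  rintro (h | h)
  · exact absurd (dim_lt_of_mem h hp) (not_lt.2 hdim)
  · exact hne (eq_of_mem_openCell h hp)

variable [CWComplex.Finite C]

/-- In a finite regular complex, the boundary of a cell is a union of closed cells. -/
lemma exists_closedCell_subset_boundary (hC : CWComplex.IsRegular C) {x : Ent C} {p : X}
    (hp : p ∈ x.boundary) : ∃ y : Ent C, y.closedCell ⊆ x.boundary ∧ p ∈ y.closedCell := by
  by_contra! hpD
  obtain ⟨φ, hemb, -, hsph⟩ := hC x.dim x.index
  have hcont : ContinuousOn φ (closedBall 0 1) :=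
    continuousOn_iff_continuous_domRestrict.2 hemb.continuous
  have hinj : InjOn φ (closedBall 0 1) := injOn_iff_injective.2 hemb.injective
  let D : Set X := ⋃ y ∈ {y | StrictFace x y}, y.closedCell
  have hD : IsClosed D := (toFinite _).isClosed_biUnion fun y _ => y.isClosed_closedCell
  have hpD' : p ∉ D := fun h => by
    simp only [D, mem_iUnion] at h
    obtain ⟨y, hy, hpy⟩ := h
    exact hpD y hy hpy
  -- Among the cells meeting the part of the boundary outside all strict faces, `y` has the largest
  -- dimension. Removing `D` and the other closed cells of dimension at most `y.dim` therefore
  -- leaves only points of the open cell `y` in the boundary.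
  obtain ⟨y, hyS, hymax⟩ := exists_max_image
    {y | ((x.boundary \ D) ∩ openCell y).Nonempty} Ent.dim (toFinite _) (by
      obtain ⟨y, hy⟩ := exists_mem_openCell (x.closedCell_subset (x.boundary_subset_closedCell hp))
      exact ⟨y, p, ⟨hp, hpD'⟩, hy⟩)
  obtain ⟨q, ⟨hqx, hqD⟩, hqy⟩ := hyS
  let O : Set X := (D ∪ ⋃ z ∈ {z | z ≠ y ∧ z.dim ≤ y.dim}, z.closedCell)ᶜ
  have hO : IsOpen O := (hD.union
    ((toFinite _).isClosed_biUnion fun y _ => y.isClosed_closedCell)).isOpen_compl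
  have hmemO : ∀ r ∈ y.openCell, r ∉ D → r ∈ O := by
    intro r hr hrD
    simp only [O, mem_compl_iff, mem_union, mem_iUnion, not_or, not_exists]
    exact ⟨hrD, fun z hz => notMem_closedCell_of_dim_le hz.1 hz.2 hr⟩
  have hxO : x.boundary ∩ O ⊆ y.openCell := by
    rintro r ⟨hrx, hrO⟩
    simp only [O, mem_compl_iff, mem_union, mem_iUnion, not_or, not_exists] at hrO
    obtain ⟨z, hz⟩ := exists_mem_openCell
      (x.closedCell_subset (x.boundary_subset_closedCell hrx))
    rcases eq_or_ne z y with rfl | hne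
    · exact hz
    · exact absurd (z.openCell_subset_closedCell hz)
        (hrO.2 z ⟨hne, hymax z ⟨r, ⟨hrx, hrO.1⟩, hz⟩⟩)
  have hx : x.boundary = φ '' sphere 0 1 := hsph.symm
  obtain ⟨h1, h2⟩ := finrank_and_isOpen_of_sphere (hcont.mono sphere_subset_closedBall)
    (hinj.mono sphere_subset_closedBall) hO (hx ▸ hxO)
  rw [← hx] at h1 h2
  have hlt := dim_lt_of_mem hqx hqy
  -- With `hlt` this forces `x.dim = y.dim + 1`. Then no strict face of `x` can meet the open cell
  -- `y`, the trace of the boundary on `y` is open, and `y` turns out to be a strict face after all.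
  have hdim := h1 ⟨q, hqx, hmemO q hqy hqD⟩
  have hyx : ¬ y.closedCell ⊆ x.boundary := fun h =>
    hqD (mem_biUnion (show y ∈ {y | StrictFace x y} from h)
      (y.openCell_subset_closedCell hqy))
  have heq : x.boundary ∩ O = x.boundary ∩ y.openCell := by
    refine Subset.antisymm (subset_inter inter_subset_left hxO) fun r hr =>
      ⟨hr.1, hmemO r hr.2 fun hrD => ?_⟩
    simp only [D, mem_iUnion] at hrD
    obtain ⟨z, hz, hrz⟩ := hrD
    have hzdim : z.dim < x.dim := StrictFace.dim_lt hz
    exact notMem_closedCell_of_dim_le (by rintro rfl; exact hyx hz) (by omega) hr.2 hrz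
  have := openCell_subset_of_isOpen_coords_image x.isClosed_boundary ⟨q, hqx, hqy⟩
    (heq ▸ h2 hlt)
  exact hyx (y.closedCell_subset_closure.trans (closure_minimal this x.isClosed_boundary))

/-- Induction on the dimension of `x`: a boundary point lies in the closed cell of a strict face,
which has smaller dimension. -/
lemma closedCell_subset_of_mem (hC : CWComplex.IsRegular C) {x y : Ent C} {p : X}
    (hx : p ∈ x.closedCell) (hy : p ∈ y.openCell) : y.closedCell ⊆ x.closedCell := by
  induction hn : x.dim using Nat.strong_induction_on generalizing x with
  | _ n ih =>
    rw [← boundary_union_openCell] at hx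
    rcases hx with hx | hx
    · obtain ⟨z, hz, hpz⟩ := exists_closedCell_subset_boundary hC hx
      have hlt : z.dim < x.dim := StrictFace.dim_lt hz
      exact (ih z.dim (hn ▸ hlt) hpz rfl).trans (Subset.trans hz x.boundary_subset_closedCell)
    · rw [eq_of_mem_openCell hx hy]

/-- In a finite regular complex, the boundary of a cell is the union of the open cells of its
strict faces. -/
theorem boundary_eq_iUnion_openCell (hC : CWComplex.IsRegular C) (x : Ent C) :
    x.boundary = ⋃ y > x, y.openCell := by
  ext p
  simp only [mem_iUnion, exists_prop, gt_iff_lt, lt_iff_strictFace]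
  constructor
  · intro hp
    obtain ⟨y, hy⟩ := exists_mem_openCell (x.closedCell_subset (x.boundary_subset_closedCell hp))
    obtain ⟨z, hz, hpz⟩ := exists_closedCell_subset_boundary hC hp
    exact ⟨y, (closedCell_subset_of_mem hC hpz hy).trans hz, hy⟩
  · rintro ⟨y, hy, hp⟩
    exact hy (y.openCell_subset_closedCell hp)

end Ent

end RegularComplex

/-! ### The order complex and the barycentric subdivision -/

section OrderComplex

open Metric Set

lemma ContinuousOn.invFunOn_of_isCompact {α β : Type*} [TopologicalSpace α] [TopologicalSpace β]
    [T2Space β] [Nonempty α] {f : α → β} {s : Set α} (hf : ContinuousOn f s) (hs : IsCompact s)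
    (hinj : InjOn f s) : ContinuousOn (Function.invFunOn f s) (f '' s) := by
  rw [continuousOn_iff_isClosed]
  intro t ht
  refine ⟨f '' (s ∩ t), ((hs.inter_right ht).image_of_continuousOn
    (hf.mono inter_subset_left)).isClosed, ?_⟩
  ext y
  constructor
  · rintro ⟨hy, x, hx, rfl⟩
    rw [mem_preimage, hinj.leftInvOn_invFunOn hx] at hy
    exact ⟨mem_image_of_mem f ⟨hx, hy⟩, mem_image_of_mem f hx⟩
  · rintro ⟨⟨x, hx, rfl⟩, -⟩
    refine ⟨?_, mem_image_of_mem f hx.1⟩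
    rw [mem_preimage, hinj.leftInvOn_invFunOn hx.1]
    exact hx.2

variable {P : Type*} [Fintype P] [PartialOrder P]

/-- The points of the geometric realization of the order complex of the subset `Q` of a finite
poset, in barycentric coordinates. -/
def orderPolytope (Q : Set P) : Set (P → ℝ) :=
  {w | w ∈ stdSimplex ℝ P ∧ (∀ p q, w p ≠ 0 → w q ≠ 0 → p ≤ q ∨ q ≤ p) ∧ ∀ p, w p ≠ 0 → p ∈ Q}

namespace orderPolytope

lemma mono {Q R : Set P} (h : Q ⊆ R) : orderPolytope Q ⊆ orderPolytope R :=
  fun _ hw => ⟨hw.1, hw.2.1, fun p hp => h (hw.2.2 p hp)⟩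

lemma isClosed (Q : Set P) : IsClosed (orderPolytope Q) := by
  have : orderPolytope Q = stdSimplex ℝ P ∩
      ((⋂ p : P, ⋂ q : P, {w | ¬ (p ≤ q ∨ q ≤ p) → w p * w q = 0}) ∩
        ⋂ p : P, {w | p ∉ Q → w p = 0}) := by
    ext w
    simp only [orderPolytope, mem_ofPred_eq, mem_inter_iff, mem_iInter, mul_eq_zero]
    refine and_congr_right fun _ => and_congr ?_ ?_
    · refine forall₂_congr fun p q => ?_
      tauto
    · refine forall_congr' fun p => ?_
      tauto
  rw [this]
  refine (isClosed_stdSimplex ℝ P).inter (IsClosed.inter ?_ ?_)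
  · refine isClosed_iInter fun p => isClosed_iInter fun q => ?_
    by_cases h : p ≤ q ∨ q ≤ p
    · simp [h]
    · simp only [h, not_false_eq_true, forall_const]
      exact isClosed_eq (by fun_prop) continuous_const
  · refine isClosed_iInter fun p => ?_
    by_cases h : p ∈ Q
    · simp [h]
    · simp only [h, not_false_eq_true, forall_const]
      exact isClosed_eq (by fun_prop) continuous_const

lemma isCompact (Q : Set P) : IsCompact (orderPolytope Q) :=
  (isCompact_stdSimplex ℝ P).of_isClosed_subset (isClosed Q) fun _ hw => hw.1

/-- The support is a nonempty finite chain. Its least element names the open cell to which a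
parametrization sends the point. -/
lemma exists_isLeast {Q : Set P} {w : P → ℝ} (hw : w ∈ orderPolytope Q) :
    ∃ p ∈ Q, w p ≠ 0 ∧ ∀ q, w q ≠ 0 → p ≤ q := by
  have hne : {p | w p ≠ 0}.Nonempty := by
    by_contra! h
    have h0 : ∀ p, w p = 0 := fun p => by
      by_contra hp
      exact (h ▸ hp : p ∈ (∅ : Set P))
    simpa [h0] using hw.1.2
  obtain ⟨p, hp⟩ := (toFinite {p | w p ≠ 0}).exists_minimal hne
  exact ⟨p, hw.2.2 p hp.1, hp.1, fun q hq => (hw.2.1 p q hp.1 hq).elim id fun h => hp.2 hq h⟩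

lemma le_one {Q : Set P} {w : P → ℝ} (hw : w ∈ orderPolytope Q) (p : P) : w p ≤ 1 :=
  (mem_Icc_of_mem_stdSimplex hw.1 p).2

lemma nonneg {Q : Set P} {w : P → ℝ} (hw : w ∈ orderPolytope Q) (p : P) : 0 ≤ w p := hw.1.1 p

lemma eq_zero_of_ne {Q : Set P} {w : P → ℝ} (hw : w ∈ orderPolytope Q) {m p : P} (hm : w m = 1)
    (hp : p ≠ m) : w p = 0 := by
  classical
  have := hw.1.2
  rw [← Finset.add_sum_erase _ _ (Finset.mem_univ m), hm] at this
  exact (Finset.sum_eq_zero_iff_of_nonneg fun q _ => hw.1.1 q).1 (by linarith) p (by simp [hp])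

variable [DecidableEq P]

/-- The radial projection of the simplices with vertex `m` away from this vertex. -/
noncomputable def link (m : P) (w : P → ℝ) : P → ℝ := (1 - w m)⁻¹ • Function.update w m 0

lemma link_mem {m : P} {w : P → ℝ} (hw : w ∈ orderPolytope (Ici m)) (h1 : w m ≠ 1) :
    link m w ∈ orderPolytope (Ioi m) := by
  have hpos : 0 < 1 - w m := sub_pos.2 (lt_of_le_of_ne (le_one hw m) h1)
  have hsupp : ∀ p, link m w p ≠ 0 → p ≠ m ∧ w p ≠ 0 := by
    intro p hp
    rcases eq_or_ne p m with rfl | hpm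
    · simp [link] at hp
    · refine ⟨hpm, ?_⟩
      simp only [link, Pi.smul_apply, Function.update_of_ne hpm, smul_eq_mul] at hp
      exact right_ne_zero_of_mul hp
  refine ⟨⟨fun p => ?_, ?_⟩, fun p q hp hq => hw.2.1 p q (hsupp p hp).2 (hsupp q hq).2,
    fun p hp => lt_of_le_of_ne (hw.2.2 p (hsupp p hp).2) (hsupp p hp).1.symm⟩
  · simp only [link, Pi.smul_apply, smul_eq_mul]
    refine mul_nonneg (inv_nonneg.2 hpos.le) ?_
    rcases eq_or_ne p m with rfl | hpm
    · simp
    · simpa [hpm] using hw.1.1 p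
  · simp only [link, Pi.smul_apply, smul_eq_mul, ← Finset.mul_sum]
    rw [Finset.sum_update_of_mem (Finset.mem_univ m), zero_add,
      ← Finset.erase_eq, inv_mul_eq_one₀ hpos.ne', ← hw.1.2,
      ← Finset.add_sum_erase _ _ (Finset.mem_univ m)]
    ring

/-- The weight at `m` and the link are polar coordinates. At the vertex `m` the link is meaningless,
but there the weight alone determines the point. -/
lemma eq_of_link_eq {m : P} {Q : Set P} {w w' : P → ℝ} (hw : w ∈ orderPolytope Q)
    (hw' : w' ∈ orderPolytope Q) (h : w m = w' m) (hl : w m ≠ 1 → link m w = link m w') :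
    w = w' := by
  funext p
  rcases eq_or_ne p m with rfl | hpm
  · exact h
  · by_cases h1 : w m = 1
    · rw [eq_zero_of_ne hw h1 hpm, eq_zero_of_ne hw' (h ▸ h1) hpm]
    · have := congrFun (hl h1) p
      simp only [link, Pi.smul_apply, Function.update_of_ne hpm, smul_eq_mul, ← h] at this
      exact mul_left_cancel₀ (inv_ne_zero (sub_ne_zero.2 (Ne.symm h1))) this

/-- The point of the join of `m` and a simplex of larger elements with weight `1 - a` at `m`. -/
noncomputable def join (m : P) (a : ℝ) (w : P → ℝ) : P → ℝ :=
  Function.update (a • w) m (1 - a)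

lemma join_mem {m : P} {a : ℝ} (ha0 : 0 ≤ a) (ha1 : a ≤ 1) {w : P → ℝ}
    (hw : w ∈ orderPolytope (Ioi m)) : join m a w ∈ orderPolytope (Ici m) := by
  have hm : w m = 0 := by
    by_contra h
    exact lt_irrefl m (hw.2.2 m h)
  have hle : ∀ p, join m a w p ≠ 0 → p = m ∨ w p ≠ 0 := by
    intro p hp
    rcases eq_or_ne p m with rfl | hpm
    · exact Or.inl rfl
    · simp only [join, Function.update_of_ne hpm, Pi.smul_apply, smul_eq_mul] at hp
      exact Or.inr (right_ne_zero_of_mul hp)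
  have hge : ∀ p, join m a w p ≠ 0 → m ≤ p := fun p hp =>
    (hle p hp).elim (fun h => h.ge) fun h => (hw.2.2 p h).le
  refine ⟨⟨fun p => ?_, ?_⟩, fun p q hp hq => ?_, hge⟩
  · rcases eq_or_ne p m with rfl | hpm
    · simpa [join] using ha1
    · simpa [join, hpm] using mul_nonneg ha0 (hw.1.1 p)
  · rw [join, Finset.sum_update_of_mem (Finset.mem_univ m), ← Finset.erase_eq]
    have := hw.1.2
    rw [← Finset.add_sum_erase _ _ (Finset.mem_univ m), hm, zero_add] at this
    simp [← Finset.mul_sum, this]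
  · rcases hle p hp with rfl | hp'
    · exact Or.inl (hge q hq)
    · rcases hle q hq with rfl | hq'
      · exact Or.inr (hge p hp)
      · exact hw.2.1 p q hp' hq'

lemma link_join {m : P} {a : ℝ} (ha : a ≠ 0) {w : P → ℝ} (hw : w ∈ orderPolytope (Ioi m)) :
    link m (join m a w) = w := by
  have hm : w m = 0 := by
    by_contra h
    exact lt_irrefl m (hw.2.2 m h)
  funext p
  rcases eq_or_ne p m with rfl | hpm
  · simp [link, hm]
  · simp [link, join, hpm, ha]

end orderPolytope

open orderPolytope

/-- A parametrization of the union of the cells `e p`, for `p ∈ Q`, by the realization of the order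
complex of `Q` which maps the open star of each element in its up-set to its cell. -/
structure IsCellParametrization {X : Type*} [TopologicalSpace X] (e : P → Set X) (Q : Set P)
    (H : (P → ℝ) → X) : Prop where
  continuousOn : ContinuousOn H (orderPolytope Q)
  injOn : InjOn H (orderPolytope Q)
  mem : ∀ w ∈ orderPolytope Q, ∀ p, w p ≠ 0 → (∀ q, w q ≠ 0 → p ≤ q) → H w ∈ e p
  surj : ∀ p ∈ Q, ∀ x ∈ e p, ∃ w ∈ orderPolytope Q, H w = x

variable {X : Type*} [TopologicalSpace X] [T2Space X] {e : P → Set X}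

/-- Extending a parametrization of the boundary of a cell radially over the cell. -/
lemma IsCellParametrization.exists_insert {V : Type*} [NormedAddCommGroup V] [NormedSpace ℝ V]
    [FiniteDimensional ℝ V] (hdisj : ∀ p q x, x ∈ e p → x ∈ e q → p = q) {Q : Set P} {m : P}
    (hQ : ∀ p ∈ Q, ∀ q, p < q → q ∈ Q) (hmQ : m ∉ Q) (hm : Ioi m ⊆ Q) {φ : V → X}
    (hφ : ContinuousOn φ (closedBall 0 1)) (hinj : InjOn φ (closedBall 0 1))
    (hball : φ '' ball 0 1 = e m) (hsph : φ '' sphere 0 1 = ⋃ q > m, e q)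
    {H₀ : (P → ℝ) → X} (h₀ : IsCellParametrization e Q H₀) :
    ∃ H, IsCellParametrization e (insert m Q) H := by
  classical
  have : ProperSpace V := FiniteDimensional.proper ℝ V
  let ψ : X → V := Function.invFunOn φ (closedBall 0 1)
  have hψc : ContinuousOn ψ (φ '' closedBall 0 1) :=
    hφ.invFunOn_of_isCompact (isCompact_closedBall 0 1) hinj
  have hψφ : ∀ v ∈ closedBall (0 : V) 1, ψ (φ v) = v := hinj.leftInvOn_invFunOn
  have hIci : Ici m ⊆ insert m Q := fun q hq =>
    (eq_or_lt_of_le hq).elim (fun h => Or.inl h.symm) fun h => Or.inr (hm h)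
  have hleast : ∀ w ∈ orderPolytope (insert m Q), w m ≠ 0 → ∀ q, w q ≠ 0 → m ≤ q := by
    intro w hw hwm q hq
    rcases hw.2.1 m q hwm hq with h | h
    · exact h
    · rcases hw.2.2 q hq with rfl | hqQ
      · exact le_rfl
      · rcases eq_or_lt_of_le h with rfl | h
        · exact le_rfl
        · exact absurd (hQ q hqQ m h) hmQ
  have hzero : ∀ w ∈ orderPolytope (insert m Q), w m = 0 → w ∈ orderPolytope Q :=
    fun w hw hwm => ⟨hw.1, hw.2.1, fun p hp => (hw.2.2 p hp).resolve_left fun h =>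
      hp (h ▸ hwm)⟩
  have hQzero : ∀ w ∈ orderPolytope Q, w m = 0 := fun w hw => by
    by_contra h
    exact hmQ (hw.2.2 m h)
  have hIoi : ∀ w ∈ orderPolytope (Ioi m), H₀ w ∈ φ '' sphere 0 1 := by
    intro w hw
    obtain ⟨p, hp, hwp, hpl⟩ := exists_isLeast hw
    rw [hsph]
    exact mem_biUnion (show p ∈ Ioi m from hp) (h₀.mem w (orderPolytope.mono hm hw) p hwp hpl)
  have hψn : ∀ w ∈ orderPolytope (Ioi m), ‖ψ (H₀ w)‖ = 1 ∧ φ (ψ (H₀ w)) = H₀ w := by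
    intro w hw
    obtain ⟨v, hv, hvw⟩ := hIoi w hw
    rw [← hvw, hψφ v (sphere_subset_closedBall hv)]
    exact ⟨mem_sphere_zero_iff_norm.1 hv, rfl⟩
  -- The cone construction: the radius is `1 - w m`, the direction is the boundary point
  -- parametrized by the link.
  let G : (P → ℝ) → V := fun w => (1 - w m) • ψ (H₀ (link m w))
  have hGn : ∀ w ∈ orderPolytope (Ici m), ‖G w‖ = 1 - w m := by
    intro w hw
    have h0 : 0 ≤ 1 - w m := sub_nonneg.2 (le_one hw m)
    by_cases h1 : w m = 1
    · simp [G, h1]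
    · rw [norm_smul, (hψn _ (link_mem hw h1)).1, mul_one, Real.norm_of_nonneg h0]
  have hGball : MapsTo G (orderPolytope (Ici m)) (closedBall 0 1) := fun w hw => by
    rw [mem_closedBall_zero_iff, hGn w hw]
    linarith [nonneg hw m]
  have hGc : ContinuousOn G (orderPolytope (Ici m)) := by
    intro w hw
    by_cases h1 : w m = 1
    -- At the cone point the link need not converge; continuity comes from the norm `1 - w m`
    -- tending to `0`.
    · have hG0 : G w = 0 := by simp [G, h1]
      rw [ContinuousWithinAt, hG0]
      refine squeeze_zero_norm' (a := fun w => 1 - w m)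
        (eventually_nhdsWithin_of_forall fun v hv => (hGn v hv).le) ?_
      have : Continuous fun w : P → ℝ => 1 - w m := by fun_prop
      have := this.continuousWithinAt (s := orderPolytope (Ici m)) (x := w)
      rwa [ContinuousWithinAt, h1, sub_self] at this
    · have hne : ∀ᶠ v in 𝓝[orderPolytope (Ici m)] w, v m ≠ 1 :=
        ((continuous_apply m).continuousAt.continuousWithinAt).eventually_ne h1
      have hmem : orderPolytope (Ici m) ∩ {v | v m ≠ 1} ∈ 𝓝[orderPolytope (Ici m)] w :=
        Filter.inter_mem self_mem_nhdsWithin hne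
      have hlink : ContinuousOn (link m) (orderPolytope (Ici m) ∩ {v | v m ≠ 1}) := by
        have hsub : Continuous fun v : P → ℝ => 1 - v m := by fun_prop
        exact (hsub.continuousOn.inv₀ fun v hv => sub_ne_zero.2 (Ne.symm hv.2)).smul
          (continuous_id.update m continuous_const).continuousOn
      have hmaps : MapsTo (link m) (orderPolytope (Ici m) ∩ {v | v m ≠ 1})
          (orderPolytope (Ioi m)) := fun v hv => link_mem hv.1 hv.2
      have hcomp : ContinuousOn G (orderPolytope (Ici m) ∩ {v | v m ≠ 1}) := by
        refine ContinuousOn.smul (by fun_prop) (hψc.comp (h₀.continuousOn.comp hlink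
          (hmaps.mono_right (orderPolytope.mono hm))) fun v hv => ?_)
        exact image_mono sphere_subset_closedBall (hIoi _ (hmaps hv))
      exact (hcomp w ⟨hw, h1⟩).mono_of_mem_nhdsWithin hmem
  have hG0 : ∀ w ∈ orderPolytope (Ici m), w m = 0 → φ (G w) = H₀ w := by
    intro w hw h0
    have hw' : w ∈ orderPolytope (Ioi m) := ⟨hw.1, hw.2.1, fun p hp =>
      lt_of_le_of_ne (hw.2.2 p hp) (by rintro rfl; exact hp h0)⟩
    have hl : link m w = w := by
      funext p
      rcases eq_or_ne p m with rfl | hpm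
      · simp [link, h0]
      · simp [link, h0, hpm]
    simp only [G, hl, h0, sub_zero, one_smul]
    exact (hψn w hw').2
  let H : (P → ℝ) → X := fun w => if w m = 0 then H₀ w else φ (G w)
  have hHQ : EqOn H H₀ (orderPolytope Q) := fun w hw => if_pos (hQzero w hw)
  have hHI : EqOn H (fun w => φ (G w)) (orderPolytope (Ici m)) := fun w hw => by
    by_cases h : w m = 0
    · simp only [H, h, if_true]
      exact (hG0 w hw h).symm
    · simp [H, h]
  have hmemI : ∀ w ∈ orderPolytope (insert m Q), w m ≠ 0 → w ∈ orderPolytope (Ici m) :=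
    fun w hw hwm => ⟨hw.1, hw.2.1, hleast w hw hwm⟩
  have hHm : ∀ w ∈ orderPolytope (insert m Q), w m ≠ 0 → H w ∈ e m := by
    intro w hw hwm
    rw [hHI (hmemI w hw hwm), ← hball]
    refine mem_image_of_mem φ ?_
    rw [mem_ball_zero_iff, hGn w (hmemI w hw hwm)]
    have := lt_of_le_of_ne (nonneg hw m) (Ne.symm hwm)
    linarith
  have hHmem : ∀ w ∈ orderPolytope (insert m Q), ∀ p, w p ≠ 0 → (∀ q, w q ≠ 0 → p ≤ q) →
      H w ∈ e p := by
    intro w hw p hp hpl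
    by_cases h : w m = 0
    · rw [hHQ (hzero w hw h)]
      exact h₀.mem w (hzero w hw h) p hp hpl
    · rw [← le_antisymm (hleast w hw h p hp) (hpl m h)]
      exact hHm w hw h
  refine ⟨H, ⟨?_, ?_, hHmem, ?_⟩⟩
  -- The two formulas agree on the overlap of these closed sets, which cover the domain.
  · refine ContinuousOn.mono (s := orderPolytope Q ∪ orderPolytope (Ici m)) ?_ fun w hw => ?_
    · exact ContinuousOn.union_of_isClosed (h₀.continuousOn.congr hHQ)
        ((hφ.comp hGc hGball).congr hHI) (orderPolytope.isClosed _) (orderPolytope.isClosed _)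
    · by_cases h : w m = 0
      · exact Or.inl (hzero w hw h)
      · exact Or.inr (hmemI w hw h)
  · have hnot : ∀ w ∈ orderPolytope (insert m Q), ∀ w' ∈ orderPolytope (insert m Q),
        H w = H w' → w m = 0 → w' m = 0 := by
      intro w hw w' hw' hww' h
      by_contra h'
      obtain ⟨p, hp, hwp, hpl⟩ := exists_isLeast hw
      have := hdisj p m (H w) (hHmem w hw p hwp hpl) (hww' ▸ hHm w' hw' h')
      exact hwp (this ▸ h)
    intro w hw w' hw' hww'
    by_cases h : w m = 0
    · have h' := hnot w hw w' hw' hww' h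
      rw [hHQ (hzero w hw h), hHQ (hzero w' hw' h')] at hww'
      exact h₀.injOn (hzero w hw h) (hzero w' hw' h') hww'
    · have h' : w' m ≠ 0 := fun h' => h (hnot w' hw' w hw hww'.symm h')
      have hI := hmemI w hw h
      have hI' := hmemI w' hw' h'
      rw [hHI hI, hHI hI'] at hww'
      have hG := hinj (hGball hI) (hGball hI') hww'
      have hmm : w m = w' m := by
        have := congrArg norm hG
        rw [hGn w hI, hGn w' hI'] at this
        linarith
      refine eq_of_link_eq hw hw' hmm fun h1 => ?_
      have hl := link_mem hI h1
      have hl' := link_mem hI' (hmm ▸ h1)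
      simp only [G, ← hmm] at hG
      have := smul_right_injective V (sub_ne_zero.2 (Ne.symm h1)) hG
      refine h₀.injOn (orderPolytope.mono hm hl) (orderPolytope.mono hm hl') ?_
      rw [← (hψn _ hl).2, ← (hψn _ hl').2, this]
  · rintro p hp x hx
    by_cases hpm : p = m
    · subst hpm
      rw [← hball] at hx
      obtain ⟨v, hv, rfl⟩ := hx
      rw [mem_ball_zero_iff] at hv
      by_cases hv0 : v = 0
      · have hs : (Pi.single p 1 : P → ℝ) ∈ orderPolytope (Ici p) := by
          have hsupp : ∀ q, (Pi.single p 1 : P → ℝ) q ≠ 0 → q = p := fun q hq => by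
            by_contra h
            exact hq (Pi.single_eq_of_ne h 1)
          exact ⟨single_mem_stdSimplex ℝ p, fun q r hq hr =>
            Or.inl ((hsupp q hq).trans (hsupp r hr).symm).le, fun q hq => (hsupp q hq).ge⟩
        refine ⟨_, orderPolytope.mono hIci hs, ?_⟩
        rw [hHI hs]
        simp [G, hv0]
      -- The direction of `v` is a boundary point, hence parametrized by some `w` over `Ioi p`. The
      -- join of `p` with `w`, with weight `‖v‖` on `w`, is sent to `φ p v`.
      · have hn : ‖v‖ ≠ 0 := norm_ne_zero_iff.2 hv0
        have hs : ‖v‖⁻¹ • v ∈ sphere (0 : V) 1 := by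
          rw [mem_sphere_zero_iff_norm, norm_smul, norm_inv, norm_norm, inv_mul_cancel₀ hn]
        have hx := mem_image_of_mem φ hs
        rw [hsph] at hx
        simp only [mem_iUnion] at hx
        obtain ⟨q, hq, hxq⟩ := hx
        obtain ⟨w, hw, hwx⟩ := h₀.surj q (hm hq) _ hxq
        have hwI : w ∈ orderPolytope (Ioi p) := by
          obtain ⟨r, hr, hwr, hrl⟩ := exists_isLeast hw
          have := hdisj q r _ (hwx ▸ hxq) (h₀.mem w hw r hwr hrl)
          exact ⟨hw.1, hw.2.1, fun s hs => lt_of_lt_of_le hq (this ▸ hrl s hs)⟩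
        have hj := join_mem (norm_nonneg v) hv.le hwI
        refine ⟨_, orderPolytope.mono hIci hj, ?_⟩
        rw [hHI hj]
        simp only [G, link_join hn hwI, hwx, hψφ _ (sphere_subset_closedBall hs)]
        simp [join, hn, smul_smul]
    · obtain ⟨w, hw, hwx⟩ := h₀.surj p (hp.resolve_left hpm) x hx
      exact ⟨w, orderPolytope.mono (subset_insert m Q) hw, (hHQ hw).trans hwx⟩

/-- A space which is a finite disjoint union of open cells, such that the boundary of each closed
cell is an embedded sphere and a union of open cells, is homeomorphic to the realization of the
order complex of its face poset. -/
theorem exists_isCellParametrization {V : P → Type*} [∀ p, NormedAddCommGroup (V p)]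
    [∀ p, NormedSpace ℝ (V p)] [∀ p, FiniteDimensional ℝ (V p)]
    (hdisj : ∀ p q x, x ∈ e p → x ∈ e q → p = q) (φ : ∀ p, V p → X)
    (hφ : ∀ p, ContinuousOn (φ p) (closedBall 0 1)) (hinj : ∀ p, InjOn (φ p) (closedBall 0 1))
    (hball : ∀ p, φ p '' ball 0 1 = e p) (hsph : ∀ p, φ p '' sphere 0 1 = ⋃ q > p, e q)
    (hX : Nonempty X) : ∃ H, IsCellParametrization e univ H := by
  classical
  suffices h : ∀ (n : ℕ) (Q : Finset P), Q.card = n → (∀ p ∈ Q, ∀ q, p < q → q ∈ Q) →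
      ∃ H, IsCellParametrization e (Q : Set P) H by
    simpa using h _ Finset.univ rfl
  intro n
  induction n with
  | zero =>
    intro Q hQ _
    obtain rfl := Finset.card_eq_zero.1 hQ
    have hempty : orderPolytope (∅ : Set P) = ∅ := by
      refine eq_empty_of_forall_notMem fun w hw => ?_
      obtain ⟨p, hp, -⟩ := exists_isLeast hw
      simp at hp
    refine ⟨fun _ => Classical.arbitrary X, ⟨?_, ?_, ?_, ?_⟩⟩ <;> simp [hempty]
  | succ n ih =>
    intro Q hcard hQ
    -- Removing a minimal element keeps `Q` closed upwards, and all elements above `m` remain, so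
    -- the boundary of its cell is already parametrized.
    obtain ⟨m, hm⟩ := Q.exists_minimal (Finset.card_pos.1 (by omega))
    have hup : ∀ p ∈ Q.erase m, ∀ q, p < q → q ∈ Q.erase m := by
      intro p hp q hpq
      rw [Finset.mem_erase] at hp ⊢
      refine ⟨?_, hQ p hp.2 q hpq⟩
      rintro rfl
      exact hpq.not_ge (hm.2 hp.2 hpq.le)
    obtain ⟨H₀, h₀⟩ := ih (Q.erase m) (by rw [Finset.card_erase_of_mem hm.1]; omega) hup
    have := h₀.exists_insert (m := m) hdisj (fun p hp q hpq => hup p hp q hpq) (by simp)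
      (fun q hq => by
        have : q ∈ Q.erase m := Finset.mem_erase.2 ⟨(ne_of_gt hq), hQ m hm.1 q hq⟩
        exact this) (hφ m) (hinj m) (hball m) (hsph m)
    rwa [← Finset.coe_insert, Finset.insert_erase hm.1] at this

lemma isEmpty_orderPolytope_of_isEmpty [IsEmpty P] (Q : Set P) : IsEmpty (orderPolytope Q) :=
  ⟨fun w => by
    obtain ⟨p, -⟩ := exists_isLeast w.2
    exact isEmptyElim p⟩

/-- A finite regular CW complex is homeomorphic to its barycentric subdivision. -/
theorem Ent.nonempty_homeomorph_orderPolytope {X : Type*} [TopologicalSpace X] [T2Space X]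
    {C : Set X} [CWComplex C] [CWComplex.Finite C] [Fintype (Ent C)]
    (hC : CWComplex.IsRegular C) :
    Nonempty (orderPolytope (univ : Set (Ent C)) ≃ₜ C) := by
  classical
  rcases isEmpty_or_nonempty (Ent C) with hE | ⟨⟨x₀⟩⟩
  · have : IsEmpty C := ⟨fun p => by
      obtain ⟨x, -⟩ := Ent.exists_mem_openCell p.2
      exact isEmptyElim x⟩
    have := isEmpty_orderPolytope_of_isEmpty (univ : Set (Ent C))
    exact ⟨Homeomorph.empty⟩
  choose φ hφ using fun x : Ent C => hC x.dim x.index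
  obtain ⟨p₀, -⟩ := x₀.openCell_nonempty
  obtain ⟨H, hH⟩ := exists_isCellParametrization (e := fun x : Ent C => x.openCell)
    (V := fun x => Fin x.dim → ℝ) (fun _ _ _ => Ent.eq_of_mem_openCell) φ
    (fun x => continuousOn_iff_continuous_domRestrict.2 (hφ x).1.continuous)
    (fun x => injOn_iff_injective.2 (hφ x).1.injective) (fun x => (hφ x).2.1)
    (fun x => (hφ x).2.2.trans (Ent.boundary_eq_iUnion_openCell hC x)) ⟨p₀⟩
  have : CompactSpace (orderPolytope (univ : Set (Ent C))) :=
    isCompact_iff_compactSpace.1 (orderPolytope.isCompact _)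
  have hmaps : ∀ w ∈ orderPolytope (univ : Set (Ent C)), H w ∈ C := fun w hw => by
    obtain ⟨x, hx, hwx, hl⟩ := exists_isLeast hw
    exact x.closedCell_subset (x.openCell_subset_closedCell (hH.mem w hw x hwx hl))
  let F : orderPolytope (univ : Set (Ent C)) → C := fun w => ⟨H w, hmaps w w.2⟩
  have hF : Continuous F :=
    (continuousOn_iff_continuous_domRestrict.1 hH.continuousOn).subtype_mk _
  have hbij : Function.Bijective F := by
    refine ⟨fun w w' h => Subtype.ext (hH.injOn w.2 w'.2 (congrArg Subtype.val h)), fun p => ?_⟩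
    obtain ⟨x, hx⟩ := Ent.exists_mem_openCell p.2
    obtain ⟨w, hw, hwp⟩ := hH.surj x (mem_univ x) p hx
    exact ⟨⟨w, hw⟩, Subtype.ext hwp⟩
  exact ⟨(Equiv.ofBijective F hbij).toHomeomorphOfIsInducing
    (hF.isClosedEmbedding hbij.1).isInducing⟩

end OrderComplex

/-! ### Points and maps of geometric realizations -/

section Realization

open Opposite

universe u

namespace GeometricRealization

/-- The point with barycentric coordinates `t` of the simplex `s` in the geometric realization. -/
noncomputable def realizationPoint {K : SSet.{u}} {n : SimplexCategory} (s : K.obj (op n))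
    (t : stdSimplex ℝ (Fin (n.len + 1))) : |K| :=
  SSet.toTop.map (SSet.yonedaEquiv.symm s) (n.toTopHomeo.symm t)

lemma continuous_realizationPoint {K : SSet.{u}} {n : SimplexCategory} (s : K.obj (op n)) :
    Continuous (realizationPoint s) :=
  (SSet.toTop.map (SSet.yonedaEquiv.symm s)).hom.continuous.comp n.toTopHomeo.symm.continuous

lemma map_realizationPoint {K L : SSet.{u}} (f : K ⟶ L) {n : SimplexCategory} (s : K.obj (op n))
    (t : stdSimplex ℝ (Fin (n.len + 1))) :
    SSet.toTop.map f (realizationPoint s t) = realizationPoint (f.app _ s) t := by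
  have : SSet.yonedaEquiv.symm s ≫ f = SSet.yonedaEquiv.symm (f.app _ s) := by
    rw [SSet.yonedaEquiv_symm_comp]
  rw [realizationPoint, realizationPoint, ← this, Functor.map_comp]
  rfl

/-- The gluing relation of the realization. -/
lemma realizationPoint_map {K : SSet.{u}} {m n : SimplexCategory} (θ : m ⟶ n) (s : K.obj (op n))
    (t : stdSimplex ℝ (Fin (m.len + 1))) :
    realizationPoint (K.map θ.op s) t = realizationPoint s (stdSimplex.map θ t) := by
  have : SSet.yonedaEquiv.symm (K.map θ.op s) = SSet.stdSimplex.map θ ≫ SSet.yonedaEquiv.symm s := by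
    rw [SSet.yonedaEquiv_symm_naturality_left]
  rw [realizationPoint, realizationPoint, this, SimplexCategory.toTopHomeo_symm_naturality_apply,
    Functor.map_comp]
  rfl

lemma homEquiv_app_down {K : SSet.{u}} {Y : TopCat.{u}} (f : |K| ⟶ Y) {n : SimplexCategory}
    (s : K.obj (op n)) (t : stdSimplex ℝ (Fin (n.len + 1))) :
    Y.toSSetObjEquiv _ ((sSetTopAdj.homEquiv K Y f).app _ s) t = f (realizationPoint s t) := by
  rw [Adjunction.homEquiv_unit]
  have := sSetTopAdj_unit_app_app_down K (op n) s
  change (((sSetTopAdj.unit.app K).app (op n) s).down ≫ f) (ULift.up t) = _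
  rw [this]
  rfl

lemma realization_hom_ext {K : SSet.{u}} {Y : TopCat.{u}} {f g : |K| ⟶ Y}
    (h : ∀ (n : SimplexCategory) (s : K.obj (op n)) t,
      f (realizationPoint s t) = g (realizationPoint s t)) : f = g := by
  apply (sSetTopAdj.homEquiv K Y).injective
  ext n s
  apply (Y.toSSetObjEquiv _).injective
  ext t
  exact (homEquiv_app_down f (n := n.unop) s t).trans
    ((h n.unop s t).trans (homEquiv_app_down g (n := n.unop) s t).symm)

/-- Every map into an indiscrete space is continuous, so the predicate "is a realization point" and
the constant `True` are two morphisms agreeing on all realization points. By `realization_hom_ext`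
they are equal. -/
lemma exists_realizationPoint_eq {K : SSet.{u}} (x : |K|) :
    ∃ (n : SimplexCategory) (s : K.obj (op n)) (t : stdSimplex ℝ (Fin (n.len + 1))),
      realizationPoint s t = x := by
  let _ : TopologicalSpace (ULift.{u} Prop) := ⊤
  let Y : TopCat.{u} := TopCat.of (ULift.{u} Prop)
  let f : |K| ⟶ Y := TopCat.ofHom ⟨fun _ => ULift.up True, continuous_const⟩
  let g : |K| ⟶ Y := TopCat.ofHom ⟨fun x => ULift.up (∃ (n : SimplexCategory) (s : K.obj (op n))
    (t : stdSimplex ℝ (Fin (n.len + 1))), realizationPoint s t = x), continuous_top⟩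
  have hfg : f = g := realization_hom_ext fun n s t =>
    congrArg ULift.up (eq_true (⟨n, s, t, rfl⟩ : ∃ (m : SimplexCategory) (s' : K.obj (op m))
      (t' : stdSimplex ℝ (Fin (m.len + 1))), realizationPoint s' t' = realizationPoint s t)).symm
  have : (ULift.up True : ULift Prop) = ULift.up _ := ConcreteCategory.congr_hom hfg x
  exact of_eq_true (ULift.up_injective this).symm

/-- A continuous map out of a geometric realization is given by compatible maps on simplices. -/
lemma exists_realization_desc {K : SSet.{u}} {Y : Type u} [TopologicalSpace Y]
    (F : ∀ (n : SimplexCategory), K.obj (op n) → stdSimplex ℝ (Fin (n.len + 1)) → Y)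
    (hF : ∀ n s, Continuous (F n s))
    (hnat : ∀ {m n : SimplexCategory} (θ : m ⟶ n) (s : K.obj (op n)) t,
      F m (K.map θ.op s) t = F n s (stdSimplex.map θ t)) :
    ∃ f : C(|K|, Y), ∀ n s t, f (realizationPoint s t) = F n s t := by
  let g : K ⟶ TopCat.toSSet.obj (TopCat.of Y) :=
    { app := fun n => ↾fun s => ((TopCat.of Y).toSSetObjEquiv n).symm ⟨F n.unop s, hF _ s⟩
      naturality := fun m n θ => by
        ext s
        apply ((TopCat.of Y).toSSetObjEquiv _).injective
        ext t
        exact hnat θ.unop s t }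
  refine ⟨((sSetTopAdj.homEquiv K (TopCat.of Y)).symm g).hom, fun n s t => ?_⟩
  have := homEquiv_app_down ((sSetTopAdj.homEquiv K (TopCat.of Y)).symm g) s t
  rw [Equiv.apply_symm_apply] at this
  exact this.symm

end GeometricRealization

end Realization

/-! ### Pushforward of barycentric coordinates -/

section StdSimplex

variable {A B : Type*} [Fintype A] [Fintype B]

lemma stdSimplex.map_apply (f : A → B) [DecidableEq B] (t : stdSimplex ℝ A) (b : B) :
    stdSimplex.map f t b = ∑ a with f a = b, t a := by
  rw [stdSimplex.map_coe, FunOnFinite.linearMap_apply_apply]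

lemma stdSimplex.map_congr_of_ne_zero {f g : A → B} {t : stdSimplex ℝ A}
    (h : ∀ a, t a ≠ 0 → f a = g a) : stdSimplex.map f t = stdSimplex.map g t := by
  classical
  ext b
  rw [stdSimplex.map_apply, stdSimplex.map_apply, Finset.sum_filter, Finset.sum_filter]
  refine Finset.sum_congr rfl fun a _ => ?_
  by_cases ha : t a = 0
  · simp [ha]
  · rw [h a ha]

lemma stdSimplex.map_eq_self_of_ne_zero {f : A → A} {t : stdSimplex ℝ A}
    (h : ∀ a, t a ≠ 0 → f a = a) : stdSimplex.map f t = t :=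
  (stdSimplex.map_congr_of_ne_zero h).trans (stdSimplex.map_id_apply t)

lemma stdSimplex.map_injective {f : A → B} (hf : Function.Injective f) :
    Function.Injective (stdSimplex.map (S := ℝ) f) := by
  intro t t' h
  have : Nonempty A := by
    by_contra hA
    rw [not_nonempty_iff] at hA
    simpa using stdSimplex.sum_eq_one t
  have hg : Function.invFun f ∘ f = id := Function.invFun_comp hf
  rw [← stdSimplex.map_id_apply t, ← stdSimplex.map_id_apply t', ← hg,
    ← stdSimplex.map_comp_apply, ← stdSimplex.map_comp_apply, h]

lemma stdSimplex.exists_map_eq [Nonempty A] {f : A → B} {t : stdSimplex ℝ B}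
    (h : ∀ b, t b ≠ 0 → ∃ a, f a = b) : ∃ t' : stdSimplex ℝ A, stdSimplex.map f t' = t := by
  refine ⟨stdSimplex.map (Function.invFun f) t, ?_⟩
  rw [stdSimplex.map_comp_apply]
  exact stdSimplex.map_eq_self_of_ne_zero fun b hb => Function.invFun_eq (h b hb)

lemma stdSimplex.map_apply_ne_zero_iff {f : A → B} {t : stdSimplex ℝ A} {b : B} :
    stdSimplex.map f t b ≠ 0 ↔ ∃ a, t a ≠ 0 ∧ f a = b := by
  classical
  rw [stdSimplex.map_apply, ne_eq,
    Finset.sum_eq_zero_iff_of_nonneg (f := fun a => t a) fun a _ => t.2.1 a]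
  simp only [Finset.mem_filter, Finset.mem_univ, true_and, not_forall]
  exact ⟨fun ⟨a, h, h'⟩ => ⟨a, h', h⟩, fun ⟨a, h, h'⟩ => ⟨a, h', h⟩⟩

end StdSimplex

/-! ### The realization of the nerve of a finite poset -/

section PosetNerve

open Opposite GeometricRealization

universe u v

/-- The nerve of a partially ordered set, with a universe lift. -/
def posetNerve (P : Type v) [PartialOrder P] : SSet.{max u v} where
  obj n := ULift.{u} (Fin (n.unop.len + 1) →o P)
  map θ := ↾fun s => ⟨s.down.comp θ.unop.toOrderHom⟩

variable {P : Type v} [PartialOrder P]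

/-- A monotone map as a simplex of the nerve. -/
def posetNerve.simplex {n : SimplexCategory} (s : Fin (n.len + 1) →o P) :
    (posetNerve.{u} P).obj (op n) := ULift.up s

/-- The map of nerves induced by a monotone map. -/
def posetNerve.map {Q : Type v} [PartialOrder Q] (f : P →o Q) :
    posetNerve.{u} P ⟶ posetNerve.{u} Q where
  app n := ↾fun s => ⟨f.comp s.down⟩

lemma exists_orderEmbedding_range_eq (S : Finset P) (hS : S.Nonempty)
    (hchain : ∀ p ∈ S, ∀ q ∈ S, p ≤ q ∨ q ≤ p) :
    ∃ (k : ℕ) (τ : Fin (k + 1) ↪o P), ∀ p, p ∈ S ↔ ∃ i, τ i = p := by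
  classical
  let _ : LinearOrder S :=
    { (inferInstance : PartialOrder S) with
      le_total := fun p q => hchain p p.2 q q.2
      toDecidableLE := Classical.decRel _ }
  obtain ⟨k, hk⟩ : ∃ k, S.card = k + 1 := Nat.exists_eq_succ_of_ne_zero hS.card_pos.ne'
  let e : Fin (k + 1) ≃o S := monoEquivOfFin S (by simpa using hk)
  refine ⟨k, e.toOrderEmbedding.trans (OrderEmbedding.subtype _), fun p => ⟨fun hp => ?_, ?_⟩⟩
  · exact ⟨e.symm ⟨p, hp⟩, by simp⟩
  · rintro ⟨i, rfl⟩
    exact (e i).2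

/-- A point of the realization of a nerve only depends on its barycentric coordinates. -/
lemma realizationPoint_eq_of_map_eq [Fintype P] {k : ℕ} (τ : Fin (k + 1) ↪o P)
    {n : SimplexCategory} (s : (posetNerve.{u} P).obj (op n)) (t : stdSimplex ℝ (Fin (n.len + 1)))
    (hτ : ∀ p, stdSimplex.map s.down t p ≠ 0 → ∃ i, τ i = p) :
    ∃ t' : stdSimplex ℝ (Fin (k + 1)), stdSimplex.map τ t' = stdSimplex.map s.down t ∧
      realizationPoint s t =
        realizationPoint (n := ⦋k⦌) (posetNerve.simplex.{u} (n := ⦋k⦌) τ.toOrderHom) t' := by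
  classical
  -- Vertices of weight zero are discarded: `ι` lists the support of `t`. Then `s ∘ ι` factors
  -- through `τ`, and the gluing relation applies to both factorizations.
  obtain ⟨m, ι, hι⟩ := exists_orderEmbedding_range_eq ({i | t i ≠ 0} : Finset (Fin (n.len + 1)))
    (by
      by_contra h
      rw [Finset.not_nonempty_iff_eq_empty, Finset.filter_eq_empty_iff] at h
      have h0 : ∀ i, t i = 0 := fun i => by simpa using h (Finset.mem_univ i)
      simpa [h0] using stdSimplex.sum_eq_one t) fun p _ q _ => le_total p q
  simp only [Finset.mem_filter, Finset.mem_univ, true_and] at hι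
  obtain ⟨t₀, ht₀⟩ := stdSimplex.exists_map_eq (f := ι) fun i hi => (hι i).1 hi
  have hmem : ∀ j, ∃ i, τ i = s.down (ι j) := fun j =>
    hτ _ (stdSimplex.map_apply_ne_zero_iff.2 ⟨ι j, (hι _).2 ⟨j, rfl⟩, rfl⟩)
  choose θ hθ using hmem
  have hθm : Monotone θ := fun i j hij => by
    rw [← τ.le_iff_le, hθ, hθ]
    exact s.down.monotone (ι.monotone hij)
  let ι' : ⦋m⦌ ⟶ n := SimplexCategory.Hom.mk ι.toOrderHom
  let θ' : ⦋m⦌ ⟶ ⦋k⦌ := SimplexCategory.Hom.mk ⟨θ, hθm⟩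
  refine ⟨stdSimplex.map θ t₀, ?_, ?_⟩
  · rw [stdSimplex.map_comp_apply, ← ht₀, stdSimplex.map_comp_apply]
    congr 1
    exact funext hθ
  · have h1 : (posetNerve.{u} P).map ι'.op s = (posetNerve.{u} P).map θ'.op
        (posetNerve.simplex.{u} (n := ⦋k⦌) τ.toOrderHom) :=
      congrArg ULift.up (OrderHom.ext _ _ (funext fun j => (hθ j).symm))
    have h2 := realizationPoint_map ι' s t₀
    have h3 := realizationPoint_map θ' (posetNerve.simplex.{u} (n := ⦋k⦌) τ.toOrderHom) t₀
    rw [← h1, h2] at h3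
    rw [← ht₀]
    exact h3

variable (P) in
/-- The realization of the nerve of a finite poset is homeomorphic to its order polytope. -/
theorem exists_homeomorph_orderPolytope [Fintype P] :
    ∃ Φ : |posetNerve.{u} P| ≃ₜ orderPolytope (Set.univ : Set P),
      ∀ (n : SimplexCategory) (s : (posetNerve.{u} P).obj (op n)) t,
        (Φ (realizationPoint s t) : P → ℝ) = stdSimplex.map s.down t := by
  classical
  have hmem : ∀ (n : SimplexCategory) (s : (posetNerve.{u} P).obj (op n))
      (t : stdSimplex ℝ (Fin (n.len + 1))),
      ((stdSimplex.map s.down t : stdSimplex ℝ P) : P → ℝ) ∈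
        orderPolytope (Set.univ : Set P) := by
    intro n s t
    refine ⟨(stdSimplex.map s.down t).2, fun p q hp hq => ?_, fun _ _ => Set.mem_univ _⟩
    obtain ⟨i, -, rfl⟩ := stdSimplex.map_apply_ne_zero_iff.1 hp
    obtain ⟨j, -, rfl⟩ := stdSimplex.map_apply_ne_zero_iff.1 hq
    exact (le_total i j).imp (fun h => s.down.monotone h) fun h => s.down.monotone h
  let G : ∀ (n : SimplexCategory), (posetNerve.{u} P).obj (op n) →
      stdSimplex ℝ (Fin (n.len + 1)) → orderPolytope (Set.univ : Set P) :=
    fun n s t => ⟨(stdSimplex.map s.down t : stdSimplex ℝ P), hmem n s t⟩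
  have hG : ∀ n s, Continuous (G n s) := fun n s =>
    Continuous.subtype_mk (continuous_subtype_val.comp (stdSimplex.continuous_map _)) _
  obtain ⟨F, hF⟩ := exists_realization_desc (K := posetNerve.{u} P)
    (Y := ULift.{u} (orderPolytope (Set.univ : Set P)))
    (fun n s t => ULift.up (G n s t)) (fun n s => continuous_uliftUp.comp (hG n s)) (by
      intro m n θ s t
      refine congrArg ULift.up (Subtype.ext ?_)
      exact congrArg (fun w : stdSimplex ℝ P => (w : P → ℝ))
        (stdSimplex.map_comp_apply θ s.down t).symm)
  let Φ : |posetNerve.{u} P| → orderPolytope (Set.univ : Set P) := fun x => (F x).down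
  have hΦc : Continuous Φ := continuous_uliftDown.comp F.continuous
  have hΦ : ∀ (n : SimplexCategory) (s : (posetNerve.{u} P).obj (op n)) t,
      (Φ (realizationPoint s t) : P → ℝ) = stdSimplex.map s.down t := by
    intro n s t
    change ((F (realizationPoint s t)).down : P → ℝ) = _
    rw [hF]
  have hsupp : ∀ w : orderPolytope (Set.univ : Set P), ∃ (k : ℕ) (τ : Fin (k + 1) ↪o P),
      ∀ p, w.1 p ≠ 0 ↔ ∃ i, τ i = p := by
    intro w
    obtain ⟨p, -, hp, -⟩ := orderPolytope.exists_isLeast w.2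
    obtain ⟨k, τ, hτ⟩ := exists_orderEmbedding_range_eq ({p | w.1 p ≠ 0} : Finset P)
      ⟨p, by simpa using hp⟩ fun p hp q hq => w.2.2.1 p q (by simpa using hp) (by simpa using hq)
    exact ⟨k, τ, fun p => by simpa using hτ p⟩
  -- Normal form: a point lies on the nondegenerate simplex spanned by the support of its
  -- coordinates. Injectivity and compactness both rest on it.
  have hnormal : ∀ (x : |posetNerve.{u} P|) (k : ℕ) (τ : Fin (k + 1) ↪o P),
      (∀ p, (Φ x).1 p ≠ 0 ↔ ∃ i, τ i = p) → ∃ t' : stdSimplex ℝ (Fin (k + 1)),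
        ((stdSimplex.map τ t' : stdSimplex ℝ P) : P → ℝ) = Φ x ∧
        x = realizationPoint (n := ⦋k⦌) (posetNerve.simplex.{u} (n := ⦋k⦌) τ.toOrderHom) t' := by
    intro x k τ hτ
    obtain ⟨n, s, t, rfl⟩ := exists_realizationPoint_eq x
    rw [hΦ] at hτ ⊢
    obtain ⟨t', h1, h2⟩ := realizationPoint_eq_of_map_eq τ s t fun p hp => (hτ p).1 hp
    exact ⟨t', by rw [h1], h2⟩
  have hinj : Function.Injective Φ := by
    intro x y hxy
    obtain ⟨k, τ, hτ⟩ := hsupp (Φ x)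
    obtain ⟨t, ht, hx⟩ := hnormal x k τ hτ
    obtain ⟨t', ht', hy⟩ := hnormal y k τ (hxy ▸ hτ)
    have : t = t' := stdSimplex.map_injective τ.injective
      (stdSimplex.ext (ht.trans ((congrArg Subtype.val hxy).trans ht'.symm)))
    rw [hx, hy, this]
  have hsurj : Function.Surjective Φ := by
    intro w
    obtain ⟨k, τ, hτ⟩ := hsupp w
    obtain ⟨t, ht⟩ := stdSimplex.exists_map_eq (f := τ) (t := (⟨w.1, w.2.1⟩ : stdSimplex ℝ P))
      fun p hp => (hτ p).1 hp
    refine ⟨realizationPoint (n := ⦋k⦌) (posetNerve.simplex.{u} (n := ⦋k⦌) τ.toOrderHom) t,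
      Subtype.ext ?_⟩
    rw [hΦ]
    exact congrArg Subtype.val ht
  -- A chain has at most `Fintype.card P` elements, so finitely many simplices cover the
  -- realization.
  have hcompact : CompactSpace |posetNerve.{u} P| := by
    let I := Σ k : Fin (Fintype.card P), Fin (k + 1) →o P
    have : ∀ k : Fin (Fintype.card P), Finite (Fin (k + 1) →o P) := fun k => DFunLike.finite _
    have hI : Finite I := inferInstance
    let f : I → Set |posetNerve.{u} P| := fun i => Set.range
      (realizationPoint (n := ⦋(i.1 : ℕ)⦌) (posetNerve.simplex.{u} (n := ⦋(i.1 : ℕ)⦌) i.2))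
    have hf : ∀ i, IsCompact (f i) := fun i => isCompact_range (continuous_realizationPoint _)
    have : Set.univ = ⋃ i, f i := by
      refine (Set.eq_univ_of_forall fun x => ?_).symm
      obtain ⟨k, τ, hτ⟩ := hsupp (Φ x)
      obtain ⟨t, -, hx⟩ := hnormal x k τ hτ
      have hk : k < Fintype.card P := by
        have := Fintype.card_le_of_injective τ τ.injective
        rw [Fintype.card_fin] at this
        omega
      exact Set.mem_iUnion.2 ⟨⟨⟨k, hk⟩, τ.toOrderHom⟩, t, hx.symm⟩
    exact ⟨this ▸ isCompact_iUnion hf⟩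
  exact ⟨(Equiv.ofBijective Φ ⟨hinj, hsurj⟩).toHomeomorphOfIsInducing
    (hΦc.isClosedEmbedding hinj).isInducing, hΦ⟩

end PosetNerve

/-! ### The standard subdivision of a prism -/

section Prism

open unitInterval

/-- A point of the subdivided prism is determined by its two projections. -/
lemma orderPolytope.prism_ext {A : Type*} [Fintype A] [PartialOrder A] {w w' : A × Fin 2 → ℝ}
    (hw : w ∈ orderPolytope (Set.univ : Set (A × Fin 2)))
    (hw' : w' ∈ orderPolytope (Set.univ : Set (A × Fin 2)))
    (h₁ : ∀ i, w (i, 0) + w (i, 1) = w' (i, 0) + w' (i, 1))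
    (h₂ : ∑ i, w (i, 1) = ∑ i, w' (i, 1)) : w = w' := by
  -- In `w` there is mass at `(i, 1)` and `(j, 0)`, so the chain condition gives `j ≤ i`. In `w'`
  -- there is mass at `(i, 0)` and `(j, 1)`, so `i ≤ j`.
  have key : ∀ i j, w' (i, 1) < w (i, 1) → w (j, 1) < w' (j, 1) → False := by
    intro i j hi hj
    have hi0 : w (i, 0) < w' (i, 0) := by linarith [h₁ i]
    have hj0 : w' (j, 0) < w (j, 0) := by linarith [h₁ j]
    have p1 : w (i, 1) ≠ 0 := (lt_of_le_of_lt (hw'.1.1 _) hi).ne'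
    have p2 : w (j, 0) ≠ 0 := (lt_of_le_of_lt (hw'.1.1 _) hj0).ne'
    have p3 : w' (i, 0) ≠ 0 := (lt_of_le_of_lt (hw.1.1 _) hi0).ne'
    have p4 : w' (j, 1) ≠ 0 := (lt_of_le_of_lt (hw.1.1 _) hj).ne'
    have hji : j ≤ i := by
      rcases hw.2.1 _ _ p1 p2 with h | h
      · exact absurd (show (1 : Fin 2) ≤ 0 from h.2) (by decide)
      · exact h.1
    have hij : i ≤ j := by
      rcases hw'.2.1 _ _ p3 p4 with h | h
      · exact h.1
      · exact absurd (show (1 : Fin 2) ≤ 0 from h.2) (by decide)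
    obtain rfl := le_antisymm hij hji
    linarith
  have h1 : ∀ i, w (i, 1) = w' (i, 1) := by
    by_contra! hne
    obtain ⟨i, hi⟩ := hne
    rcases lt_or_gt_of_ne hi with h | h
    · exact h₂.not_lt (Finset.sum_lt_sum (fun j _ => not_lt.1 fun hj => key j i hj h)
        ⟨i, Finset.mem_univ i, h⟩)
    · exact h₂.symm.not_lt (Finset.sum_lt_sum (fun j _ => not_lt.1 fun hj => key i j h hj)
        ⟨i, Finset.mem_univ i, h⟩)
  funext ⟨i, k⟩
  fin_cases k
  · have := h₁ i
    rw [h1 i] at this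
    simpa using this
  · exact h1 i

/-- The partial sums of the barycentric coordinates of a point of a simplex. -/
noncomputable def partialSum {N : ℕ} (t : Fin N → ℝ) (m : ℕ) : ℝ :=
  ∑ j : Fin N, if (j : ℕ) < m then t j else 0

lemma partialSum_succ {N : ℕ} (t : Fin N → ℝ) (i : Fin N) :
    partialSum t (i + 1) = partialSum t i + t i := by
  have : ∀ j : Fin N, (if (j : ℕ) < i + 1 then t j else 0) =
      (if (j : ℕ) < i then t j else 0) + if j = i then t j else 0 := by
    intro j
    rcases lt_trichotomy (j : ℕ) i with h | h | h
    · have h' : j ≠ i := fun e => h.ne (congrArg Fin.val e)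
      simp only [h, h', h.trans (Nat.lt_succ_self _), if_true, if_false, add_zero]
    · obtain rfl : j = i := Fin.ext h
      simp
    · have h' : j ≠ i := fun e => h.ne' (congrArg Fin.val e)
      have h'' : ¬ ((j : ℕ) < i + 1) := by omega
      simp only [h', h'', h.not_gt, if_false, add_zero]
  simp only [partialSum, this, Finset.sum_add_distrib]
  simp

lemma partialSum_mono {N : ℕ} {t : Fin N → ℝ} (ht : ∀ i, 0 ≤ t i) : Monotone (partialSum t) := by
  intro a b hab
  refine Finset.sum_le_sum fun j _ => ?_
  by_cases h : (j : ℕ) < a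
  · simp [h, h.trans_le hab]
  · simp only [h, if_false]
    split_ifs
    · exact ht j
    · exact le_rfl

/-- The standard subdivision of the prism over a simplex, as a map to the order polytope. -/
lemma exists_prism (N : ℕ) : ∃ W : stdSimplex ℝ (Fin N) × I →
    orderPolytope (Set.univ : Set (Fin N × Fin 2)), Continuous W ∧ ∀ t u,
      (∀ i, (W (t, u)).1 (i, 0) + (W (t, u)).1 (i, 1) = t i) ∧
      ∑ i, (W (t, u)).1 (i, 1) = u := by
  -- The mass of `t` goes to the bottom layer, in increasing order of vertices, until the amount `1
  -- - u` is used up; the rest goes on top. Bottom indices thus never exceed top ones, and the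
  -- support is a chain.
  let a : stdSimplex ℝ (Fin N) × I → Fin N → ℝ := fun x i =>
    min (partialSum x.1 (i + 1)) (1 - x.2) - min (partialSum x.1 i) (1 - x.2)
  let w : stdSimplex ℝ (Fin N) × I → Fin N × Fin 2 → ℝ := fun x p =>
    if p.2 = 0 then a x p.1 else x.1 p.1 - a x p.1
  have hw0 : ∀ x i, w x (i, 0) = a x i := fun x i => if_pos rfl
  have hw1 : ∀ x i, w x (i, 1) = x.1 i - a x i := fun x i => if_neg (show ¬ (1 : Fin 2) = 0 by decide)
  have hps : ∀ m, Continuous fun x : stdSimplex ℝ (Fin N) × I => partialSum x.1 m := by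
    intro m
    refine continuous_finsetSum _ fun j _ => ?_
    split_ifs
    · exact (continuous_apply j).comp (continuous_subtype_val.comp continuous_fst)
    · exact continuous_const
  have hac : ∀ i, Continuous fun x => a x i := by
    intro i
    have h1 := hps (i + 1)
    have h2 := hps i
    have h3 : Continuous fun x : stdSimplex ℝ (Fin N) × I => 1 - (x.2 : ℝ) :=
      continuous_const.sub (continuous_subtype_val.comp continuous_snd)
    exact (h1.min h3).sub (h2.min h3)
  have hwc : Continuous w := by
    refine continuous_pi fun p => ?_
    simp only [w]
    split_ifs
    · exact hac p.1
    · exact ((continuous_apply p.1).comp (continuous_subtype_val.comp continuous_fst)).sub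
        (hac p.1)
  have hle : ∀ (x : stdSimplex ℝ (Fin N) × I) (i : Fin N),
      partialSum x.1 i ≤ partialSum x.1 (i + 1) := fun x i =>
    partialSum_mono x.1.2.1 (Nat.le_add_right _ 1)
  have ha0 : ∀ x i, 0 ≤ a x i := fun x i => sub_nonneg.2 (min_le_min_right _ (hle x i))
  have ha1 : ∀ x i, a x i ≤ x.1 i := by
    intro x i
    have h := partialSum_succ x.1 i
    have h0 : 0 ≤ x.1 i := x.1.2.1 i
    simp only [a, h]
    rcases le_total (partialSum x.1 i) (1 - x.2) with h1 | h1
    · rw [min_eq_left h1]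
      linarith [min_le_left (partialSum x.1 i + x.1 i) (1 - (x.2 : ℝ))]
    · rw [min_eq_right h1]
      linarith [min_le_right (partialSum x.1 i + x.1 i) (1 - (x.2 : ℝ))]
  have hasum : ∀ x, ∑ i, a x i = 1 - x.2 := by
    intro x
    have h1 := Fin.sum_univ_eq_sum_range (fun i : ℕ =>
      min (partialSum x.1 (i + 1)) (1 - (x.2 : ℝ)) - min (partialSum x.1 i) (1 - (x.2 : ℝ))) N
    have h2 : partialSum x.1 N = 1 := by
      rw [← stdSimplex.sum_eq_one x.1]
      exact Finset.sum_congr rfl fun j _ => if_pos j.2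
    have h3 : partialSum x.1 0 = 0 := Finset.sum_eq_zero fun j _ => if_neg (Nat.not_lt_zero _)
    rw [Finset.sum_range_sub (fun i => min (partialSum x.1 i) (1 - (x.2 : ℝ))), h2, h3] at h1
    refine h1.trans ?_
    rw [min_eq_right (by linarith [x.2.2.1]), min_eq_left (by linarith [x.2.2.2]), sub_zero]
  have hlt : ∀ x i, w x (i, 0) ≠ 0 → partialSum x.1 i < 1 - x.2 := by
    intro x i h
    by_contra! h'
    refine h ?_
    rw [hw0]
    simp only [a]
    rw [min_eq_right h', min_eq_right (h'.trans (hle x i)),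
      sub_self]
  have hgt : ∀ x i, w x (i, 1) ≠ 0 → 1 - x.2 < partialSum x.1 (i + 1) := by
    intro x i h
    by_contra! h'
    refine h ?_
    rw [hw1]
    simp only [a]
    rw [min_eq_left h', min_eq_left ((hle x i).trans h'),
      partialSum_succ]
    ring
  have h01 : ∀ x i j, w x (i, 0) ≠ 0 → w x (j, 1) ≠ 0 → i ≤ j := by
    intro x i j hi hj
    by_contra! hlt'
    have h1 : partialSum x.1 (j + 1) ≤ partialSum x.1 i := partialSum_mono x.1.2.1 hlt'
    linarith [hlt x i hi, hgt x j hj]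
  have hmem : ∀ x, w x ∈ orderPolytope (Set.univ : Set (Fin N × Fin 2)) := by
    intro x
    refine ⟨⟨fun p => ?_, ?_⟩, ?_, fun _ _ => Set.mem_univ _⟩
    · simp only [w]
      split_ifs
      · exact ha0 x p.1
      · exact sub_nonneg.2 (ha1 x p.1)
    · rw [Fintype.sum_prod_type]
      simp only [Fin.sum_univ_two, hw0, hw1, add_sub_cancel]
      exact stdSimplex.sum_eq_one x.1
    · rintro ⟨i, k⟩ ⟨j, l⟩ hi hj
      fin_cases k <;> fin_cases l
      · exact (le_total i j).imp (fun h => ⟨h, le_rfl⟩) fun h => ⟨h, le_rfl⟩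
      · exact Or.inl ⟨h01 x i j hi hj, show (0 : Fin 2) ≤ 1 by decide⟩
      · exact Or.inr ⟨h01 x j i hj hi, show (0 : Fin 2) ≤ 1 by decide⟩
      · exact (le_total i j).imp (fun h => ⟨h, le_rfl⟩) fun h => ⟨h, le_rfl⟩
  refine ⟨fun x => ⟨w x, hmem x⟩, hwc.subtype_mk _, fun t u => ⟨fun i => ?_, ?_⟩⟩
  · simp [hw0, hw1]
  · simp only [hw1, Finset.sum_sub_distrib, hasum]
    have := stdSimplex.sum_eq_one t
    simp only [this]
    ring

end Prism

/-! ### From simplicial homotopies to homotopies -/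

section Homotopy

open Opposite GeometricRealization

universe u

/-- Realizations of simplicially homotopic maps are homotopic. -/
theorem homotopic_realization_of_simplicial {K L : SSet.{u}} (f g : K ⟶ L)
    (h : ∀ n : SimplexCategory, K.obj (op n) → (Fin (n.len + 1) →o Fin 2) → L.obj (op n))
    (hnat : ∀ {m n : SimplexCategory} (θ : m ⟶ n) (s : K.obj (op n)) (ε : Fin (n.len + 1) →o Fin 2),
      h m (K.map θ.op s) (ε.comp θ.toOrderHom) = L.map θ.op (h n s ε))
    (h₀ : ∀ n s, h n s (OrderHom.const _ 0) = f.app (op n) s)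
    (h₁ : ∀ n s, h n s (OrderHom.const _ 1) = g.app (op n) s) :
    ContinuousMap.Homotopic (SSet.toTop.map f).hom (SSet.toTop.map g).hom := by
  choose W hWc hW using fun n : SimplexCategory => exists_prism (n.len + 1)
  choose Φ hΦ using fun n : SimplexCategory =>
    exists_homeomorph_orderPolytope.{u} (Fin (n.len + 1) × Fin 2)
  let pr : ∀ {k n : SimplexCategory}, (Fin (k.len + 1) →o Fin (n.len + 1) × Fin 2) → (k ⟶ n) :=
    fun z => SimplexCategory.Hom.mk (OrderHom.fst.comp z)
  -- The homotopy on the prism over `s`: a chain in `[n] × [1]` consists of an operator to `[n]`,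
  -- applied to `s`, and a monotone map to `[1]`.
  let Ψ : ∀ (n : SimplexCategory), K.obj (op n) →
      (posetNerve.{u} (Fin (n.len + 1) × Fin 2) ⟶ L) := fun n s =>
    { app := fun k => ↾fun z => h k.unop
        (K.map (pr z.down).op s)
        (OrderHom.snd.comp z.down)
      naturality := fun k l θ => by
        ext z
        have := hnat θ.unop
          (K.map (pr z.down).op s)
          (OrderHom.snd.comp z.down)
        refine Eq.trans ?_ this
        refine congrArg (fun y => h l.unop y _) ?_
        rw [← ConcreteCategory.comp_apply, ← K.map_comp]
        rfl }
  let F : ∀ (n : SimplexCategory), K.obj (op n) →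
      C(stdSimplex ℝ (Fin (n.len + 1)) × unitInterval, |L|) := fun n s =>
    ⟨fun x => SSet.toTop.map (Ψ n s) ((Φ n).symm (W n x)),
      (SSet.toTop.map (Ψ n s)).hom.continuous.comp ((Φ n).symm.continuous.comp (hWc n))⟩
  have hFnat : ∀ {m n : SimplexCategory} (θ : m ⟶ n) (s : K.obj (op n)) t u,
      F m (K.map θ.op s) (t, u) = F n s (stdSimplex.map θ t, u) := by
    intro m n θ s t u
    let q : Fin (m.len + 1) × Fin 2 →o Fin (n.len + 1) × Fin 2 :=
      ⟨fun p => (θ.toOrderHom p.1, p.2), fun p p' hp => ⟨θ.toOrderHom.monotone hp.1, hp.2⟩⟩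
    have hΨ : Ψ m (K.map θ.op s) = posetNerve.map q ≫ Ψ n s := by
      ext k z
      refine congrArg (fun y => h k.unop y _) ?_
      rw [← ConcreteCategory.comp_apply, ← K.map_comp]
      rfl
    have hq : SSet.toTop.map (posetNerve.map.{u} q) ((Φ m).symm (W m (t, u))) =
        (Φ n).symm (W n (stdSimplex.map θ t, u)) := by
      apply (Φ n).injective
      rw [Homeomorph.apply_symm_apply]
      obtain ⟨y, hy⟩ : ∃ y, (Φ m).symm (W m (t, u)) = y := ⟨_, rfl⟩
      have hy' : W m (t, u) = Φ m y := by rw [← hy, Homeomorph.apply_symm_apply]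
      have hW' := hW m t u
      rw [hy'] at hW'
      rw [hy]
      obtain ⟨k, z, r, rfl⟩ := exists_realizationPoint_eq y
      rw [map_realizationPoint]
      apply Subtype.ext
      have e1 : ((Φ n (realizationPoint ((posetNerve.map.{u} q).app _ z) r)) :
          Fin (n.len + 1) × Fin 2 → ℝ) = stdSimplex.map q (stdSimplex.map z.down r) := by
        rw [hΦ, stdSimplex.map_comp_apply]
        rfl
      rw [hΦ] at hW'
      have hsum : ∀ i k, stdSimplex.map q (stdSimplex.map z.down r) (i, k) =
          ∑ j with θ.toOrderHom j = i, stdSimplex.map z.down r (j, k) := by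
        intro i k
        rw [stdSimplex.map_apply, Finset.sum_filter, Fintype.sum_prod_type, Finset.sum_filter]
        refine Finset.sum_congr rfl fun j _ => ?_
        have hqj : ∀ c, q (j, c) = (θ.toOrderHom j, c) := fun _ => rfl
        simp only [hqj, Prod.mk.injEq]
        by_cases hj : θ.toOrderHom j = i
        · fin_cases k <;> simp [hj]
        · simp [hj]
      -- Rather than comparing subdivision formulas, only the two projections are compared: pushing
      -- along `q` applies `θ` to the first and preserves the second.
      refine orderPolytope.prism_ext (Subtype.prop _) (Subtype.prop _) (fun i => ?_) ?_
      · rw [(hW n _ u).1 i, e1, hsum, hsum, ← Finset.sum_add_distrib,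
          Finset.sum_congr rfl fun j _ => hW'.1 j, stdSimplex.map_apply]
        rfl
      · rw [(hW n _ u).2, e1, Finset.sum_congr rfl fun i _ => hsum i 1, Finset.sum_fiberwise]
        exact hW'.2
    change SSet.toTop.map (Ψ m (K.map θ.op s)) _ = _
    rw [hΨ, Functor.map_comp, ConcreteCategory.comp_apply, hq]
    rfl
  have hend : ∀ (n : SimplexCategory) (s : K.obj (op n)) t (u : unitInterval) (c : Fin 2),
      (u : ℝ) = ((c : ℕ) : ℝ) →
      F n s (t, u) = realizationPoint (h n s (OrderHom.const _ c)) t := by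
    intro n s t u c hc
    let z : (posetNerve.{u} (Fin (n.len + 1) × Fin 2)).obj (op n) :=
      ⟨⟨fun i => (i, c), fun i j hij => ⟨hij, le_rfl⟩⟩⟩
    have hz : W n (t, u) = Φ n (realizationPoint z t) := by
      apply Subtype.ext
      have hval : ∀ i k, stdSimplex.map z.down t (i, k) = if k = c then t i else 0 := by
        intro i k
        rw [stdSimplex.map_apply, Finset.sum_filter]
        have hzj : ∀ j, z.down j = (j, c) := fun _ => rfl
        simp only [hzj, Prod.mk.injEq]
        by_cases hk : k = c
        · simp [hk]
        · simp [hk, Ne.symm hk]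
      refine orderPolytope.prism_ext (Subtype.prop _) (Subtype.prop _) (fun i => ?_) ?_
      · rw [(hW n t u).1, hΦ, hval, hval]
        fin_cases c <;> simp
      · rw [(hW n t u).2, hΦ, hc]
        simp only [hval]
        fin_cases c
        · simp
        · simp
    change SSet.toTop.map (Ψ n s) ((Φ n).symm (W n (t, u))) = _
    rw [hz, Homeomorph.symm_apply_apply, map_realizationPoint]
    congr 1
    change h n (K.map (𝟙 (op n)) s) _ = _
    rw [K.map_id]
    rfl
  -- Currying makes the homotopy a map out of `|K|` alone, so products of realizations with the
  -- interval need no separate treatment.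
  obtain ⟨G, hG⟩ := exists_realization_desc (K := K) (Y := C(unitInterval, |L|))
    (fun n s t => (F n s).curry t) (fun n s => (F n s).curry.continuous)
    (fun θ s t => ContinuousMap.ext fun u => hFnat θ s t u)
  refine ⟨⟨⟨fun x => G x.2 x.1, ?_⟩, fun x => ?_, fun x => ?_⟩⟩
  · fun_prop
  · obtain ⟨n, s, t, rfl⟩ := exists_realizationPoint_eq x
    change G (realizationPoint s t) 0 = SSet.toTop.map f (realizationPoint s t)
    rw [hG, map_realizationPoint, ← h₀]
    exact hend n s t 0 0 (by simp)
  · obtain ⟨n, s, t, rfl⟩ := exists_realizationPoint_eq x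
    change G (realizationPoint s t) 1 = SSet.toTop.map g (realizationPoint s t)
    rw [hG, map_realizationPoint, ← h₁]
    exact hend n s t 1 1 (by simp)

end Homotopy

/-! ### The nerve of the entrance path category and the poset of cells -/

section EntranceNerve

open Opposite PCategory

universe u

variable {X : Type u} [TopologicalSpace X] {C : Set X} [CWComplex C]

namespace Ent

lemma EntrancePath.mem_tail {x y : Ent C} (f : EntrancePath x y) (h : x ≠ y) :
    y ∈ f.cells.tail := by
  have hy := List.mem_of_getLast? f.last_eq
  rw [f.cells_eq, List.mem_cons] at hy
  exact hy.resolve_left h.symm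

lemma EntrancePath.le {x y : Ent C} (f : EntrancePath x y) : x ≤ y := by
  by_cases h : x = y
  · exact h.le
  · have hchain := f.isChain
    rw [f.cells_eq] at hchain
    have : IsTrans (Ent C) StrictFace := ⟨fun _ _ _ => StrictFace.trans⟩
    exact Or.inr (List.rel_of_pairwise_cons hchain.pairwise (f.mem_tail h))

open Classical in
/-- The shortest entrance path between two comparable cells. -/
noncomputable def minPath {x y : Ent C} (h : x ≤ y) : x ⟶ y :=
  { cells := if x = y then [x] else [x, y]
    isChain := by
      split_ifs with hxy
      · exact List.isChain_singleton x
      · exact List.isChain_pair.2 (h.resolve_left hxy)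
    head_eq := by split_ifs <;> rfl
    last_eq := by
      split_ifs with hxy
      · rw [hxy]
        rfl
      · rfl : EntrancePath x y }

/-- Every path starts at `x` and ends at `y`, so it contains both as a subsequence. -/
lemma minPath_le {x y : Ent C} (h : x ≤ y) (f : x ⟶ y) : minPath h ≤ f := by
  classical
  change List.Sublist (if x = y then [x] else [x, y]) (EntrancePath.cells f)
  rw [EntrancePath.cells_eq f]
  split_ifs with hxy
  · exact (List.nil_sublist _).cons_cons x
  · exact (List.singleton_sublist.2 (EntrancePath.mem_tail f hxy)).cons_cons x

lemma minPath_self (x : Ent C) : minPath (le_refl x) = 𝟙 x :=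
  EntrancePath.ext (if_pos rfl)

/-- The simplex of shortest entrance paths along a monotone sequence of cells. -/
noncomputable def minSimplex {n : ℕ} (z : Fin (n + 1) →o Ent C) : NerveSimplex (Ent C) n where
  obj := z
  hom _ _ h := minPath (z.monotone h)
  hom_self _ := minPath_self _
  hom_le _ _ _ _ _ := minPath_le _ _

open Classical in
/-- The simplex obtained by replacing the morphisms which start at a vertex of value `0` by
shortest entrance paths. -/
noncomputable def mixedSimplex {n : ℕ} (s : NerveSimplex (Ent C) n) (ε : Fin (n + 1) →o Fin 2) :
    NerveSimplex (Ent C) n where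
  obj := s.obj
  hom i j h := if ε i = 1 then s.hom i j h else minPath (EntrancePath.le (s.hom i j h))
  hom_self i := by
    rw [s.hom_self]
    split_ifs
    · rfl
    · exact minPath_self _
  hom_le i j k hij hjk := by
    -- If `ε i = 1` then monotonicity gives `ε j = 1`, and all three morphisms are the old ones.
    -- Otherwise the left side is a least path, below any composite.
    by_cases hi : ε i = 1
    · have hj : ε j = 1 := le_antisymm (Fin.le_last _) (hi ▸ ε.monotone hij)
      simp only [hi, hj, if_true]
      exact s.hom_le i j k hij hjk
    · simp only [hi, if_false]
      exact minPath_le _ _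

variable (C) in
/-- The vertices of a simplex of the nerve of the entrance path category. -/
def nerveVertices : geometricNerve (Ent C) ⟶ posetNerve.{u} (Ent C) where
  app n := ↾fun s => ⟨⟨s.obj, fun i j h => EntrancePath.le (s.hom i j h)⟩⟩

variable (C) in
/-- The section of `nerveVertices` given by shortest entrance paths. -/
noncomputable def nerveSection : posetNerve.{u} (Ent C) ⟶ geometricNerve (Ent C) where
  app n := ↾fun z => minSimplex z.down

lemma nerveSection_comp_nerveVertices : nerveSection C ≫ nerveVertices C = 𝟙 _ := rfl

/-- The homotopy is `mixedSimplex`: for `ε = 0` every morphism is replaced by a least path, for `ε =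
1` none is. -/
lemma homotopic_nerveVertices_comp_nerveSection :
    ContinuousMap.Homotopic (SSet.toTop.map (nerveVertices C ≫ nerveSection C)).hom
      (SSet.toTop.map (𝟙 (geometricNerve (Ent C)))).hom := by
  refine homotopic_realization_of_simplicial _ _ (fun n s ε => mixedSimplex s ε)
    (fun θ s ε => rfl) (fun n s => ?_) fun n s => ?_
  · refine NerveSimplex.ext rfl (heq_of_eq ?_)
    funext i j h
    have h0 : ¬ (OrderHom.const (Fin (n.len + 1)) (0 : Fin 2)) i = 1 :=
      show ¬ (0 : Fin 2) = 1 by decide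
    exact if_neg (t := s.hom i j h) h0
  · refine NerveSimplex.ext rfl (heq_of_eq ?_)
    funext i j h
    have h1 : (OrderHom.const (Fin (n.len + 1)) (1 : Fin 2)) i = 1 := rfl
    exact if_pos (e := minPath (EntrancePath.le (s.hom i j h))) h1

variable (C) in
/-- The realization of the poset of cells is homotopy equivalent to the classifying space of the
entrance path category. -/
noncomputable def homotopyEquivClassifyingSpace :
    |posetNerve.{u} (Ent C)| ≃ₕ |geometricNerve (Ent C)| where
  toFun := (SSet.toTop.map (nerveSection C)).hom
  invFun := (SSet.toTop.map (nerveVertices C)).hom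
  left_inv := by
    rw [← TopCat.hom_comp, ← Functor.map_comp, nerveSection_comp_nerveVertices,
      CategoryTheory.Functor.map_id]
    exact .refl _
  right_inv := by
    rw [← TopCat.hom_comp, ← Functor.map_comp]
    refine homotopic_nerveVertices_comp_nerveSection.trans ?_
    rw [CategoryTheory.Functor.map_id]
    exact .refl _

end Ent

end EntranceNerve

theorem proposition3p3 {X : Type*} [TopologicalSpace X] [T2Space X]
    (C : Set X) [CWComplex C] [CWComplex.Finite C] (hC : CWComplex.IsRegular C) :
    Nonempty (C ≃ₕ PCategory.classifyingSpace (Ent C)) := by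
  let _ : Fintype (Ent C) := Fintype.ofFinite _
  obtain ⟨e⟩ := Ent.nonempty_homeomorph_orderPolytope hC
  obtain ⟨Φ, -⟩ := exists_homeomorph_orderPolytope (Ent C)
  exact ⟨(Φ.trans e).symm.toHomotopyEquiv.trans (Ent.homotopyEquivClassifyingSpace C)⟩
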